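/- **Setting.** Let $\mathbb T^2=(\mathbb R/\mathbb Z)^2$ with Lebesgue measure $\lambda_2$, let $\mathrm{Diff}^\infty(\mathbb T^2,\lambda_2)$ be the set of $\lambda_2$-preserving $C^\infty$ diffeomorphisms, and let spaces of $C^\infty$ maps carry the $C^\infty$ topology, given by $d(f,g)=\sum_k 2^{-k}\min(1,\|f-g\|_k)$, where $\|f-g\|_0$ is the uniform distance and $\|f-g\|_k$, $k\ge1$, the uniform distance of the $k$-th derivatives. Let $\sigma_0,\sigma_1,\dots$ enumerate without repetition the finite sequences in $\mathbb N$ so that every initial segment of $\sigma_n$ is some $\sigma_m$ with $m\le n$. $\mathcal Trees$ is the space of sets $\mathcal T$ of finite sequences in $\mathbb N$ that contain $\emptyset$, are closed under initial segments and contain sequences of every length, with the topology induced from $\{0,1\}^{\mathbb N^{<\mathbb N}}$. Let $(\varepsilon_n)$ be a decreasing summable sequence of positive numbers, and $R_\alpha(y_1,y_2)=(y_1+\alpha,y_2)$. **The maps $F^s$.** For each $\mathcal T\in\mathcal Trees$ the following is given (everything depends on $\mathcal T$). * A construction sequence $(\mathcal W_n)$ of finite sets of words over an alphabet of $2^{12}$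 letters: $\mathcal W_0$ consists of the one-letter words; all words of $\mathcal W_n$ have the same length; $|\mathcal W_n|=:s_n$ is a power of $2$; each word of $\mathcal W_{n+1}$ is a concatenation of $k_n$ words of $\mathcal W_n$, in which every word of $\mathcal W_n$ occurs exactly $f_n\ge1$ times; and if $w_1\cdots w_{k_n}$ and $w_1'\cdots w_{k_n}'$ are in $\mathcal W_{n+1}$ (with $w_i,w_i'\in\mathcal W_n$), then $w_{i+1}\cdots w_{i+k}\ne w'_1\cdots w'_k$ whenever $k\ge\lfloor k_n/2\rfloor$ and $1\le i\le k_n-k$. Each $\mathcal W_n$ is listed in some order as $w^{(n)}_0,\dots,w^{(n)}_{s_n-1}$. * Positive integers $l_n$. Put $p_0=0$, $q_0=1$, $q_{n+1}=k_nl_nq_n^2$, $p_{n+1}=p_nk_nl_nq_n+1$, $\alpha_n=p_n/q_n$. * Maps $h_n\in\mathrm{Diff}^\infty(\mathbb T^2,\lambda_2)$, $n\ge1$, such that $h_{n+1}R_{\alpha_n}=R_{\alpha_n}h_{n+1}$ and, off a set of measure at most $\varepsilon_n$, for all $0\le i<q_n$, $0\le j<k_n$, $0\le s<s_{n+1}$,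 $h_{n+1}$ maps $\big[\tfrac{ik_n+j}{k_nq_n},\tfrac{ik_n+j+1}{k_nq_n}\big)\times\big[\tfrac s{s_{n+1}},\tfrac{s+1}{s_{n+1}}\big)$ into $\big[\tfrac i{q_n},\tfrac{i+1}{q_n}\big)\times\big[\tfrac r{s_n},\tfrac{r+1}{s_n}\big)$, where $w^{(n)}_r$ is the $n$-word in position $j$ (counted from $0$) of $w^{(n+1)}_s$. * With $H_n=h_1\circ\cdots\circ h_n$ and $T_n=H_n\circ R_{\alpha_n}\circ H_n^{-1}$ (so $T_0=\mathrm{Id}$), the $l_n$ grow so fast that $d(T_n,T_{n+1})<\varepsilon_n$ for all $n\ge0$. If $\sigma_{\nu}$ is the $n$-th element of $\mathcal T$ in the enumeration (counted from $n=0$), the listed sets $\mathcal W_m$ ($m\le n$) and $k_m,l_m,h_{m+1}$ ($m<n$) depend only on $\mathcal T\cap\{\sigma_m: m\le\nu\}$. Let $F^s:\mathcal Trees\to\mathrm{Diff}^\infty(\mathbb T^2,\lambda_2)$ be such that $F^s(\mathcal T)=\lim_n T_n$ in the $C^\infty$ topology for every $\mathcal T$; that is, $F^s$ is given by smooth Anosov–Katok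 realizations of circular systems built from $\mathcal T$. **Proposition.** For each such $F^s$ and each $\mathcal T\in\mathcal Trees$, the diffeomorphism $T=F^s(\mathcal T)$ is $C^\infty$ isotopic to the identity through $\lambda_2$-preserving diffeomorphisms: there is a $C^\infty$ map $I:\mathbb T^2\times[0,1]\to\mathbb T^2$ such that $I(\cdot,0)=\mathrm{Id}$, $I(\cdot,1)=T$ and $I(\cdot,t)\in\mathrm{Diff}^\infty(\mathbb T^2,\lambda_2)$ for all $t\in[0,1]$. Moreover, these isotopies $I=I_{\mathcal T}$ can be chosen such that $\mathcal T\mapsto I_{\mathcal T}$ is a continuous map from $\mathcal Trees$ to $C^\infty(\mathbb T^2\times[0,1],\mathbb T^2)$. -/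

import Mathlib

open Set Filter Topology MeasureTheory
open scoped ENNReal ContDiff

noncomputable section

/-! ## Smooth maps into the torus and the smooth topology -/

/-- The two-dimensional torus `(ℝ/ℤ)²`; `volume` on it is the Lebesgue probability measure `λ₂`. -/
abbrev Torus : Type := UnitAddCircle × UnitAddCircle

/-- The universal covering `ℝ² → (ℝ/ℤ)²`. -/
def torusProj (z : ℝ × ℝ) : Torus := ((z.1 : UnitAddCircle), (z.2 : UnitAddCircle))

section SmoothMaps

variable {E X : Type*} [NormedAddCommGroup E] [NormedSpace ℝ E]

/-- Let `p` map the (convex) set `S ⊆ E` onto `X` as a universal covering. Then `g : E → ℝ²` is a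
smooth lift of `f : X → (ℝ/ℤ)²`, restricted to `S`. -/
structure IsSmoothLift (p : E → X) (S : Set E) (f : X → Torus) (g : E → ℝ × ℝ) : Prop where
  contDiffOn : ContDiffOn ℝ ∞ g S
  lifts : ∀ z ∈ S, torusProj (g z) = f (p z)

/-- The space `C^∞(X, (ℝ/ℤ)²)`, where `X` is covered by `S` through `p`; as `S` is simply
connected, the smooth maps are the maps that have a smooth lift. -/
structure SmoothMap (p : E → X) (S : Set E) where
  toFun : X → Torus
  exists_lift : ∃ g, IsSmoothLift p S toFun g

namespace SmoothMap

variable {p : E → X} {S : Set E}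

instance : CoeFun (SmoothMap p S) (fun _ => X → Torus) := ⟨SmoothMap.toFun⟩

/-- A smooth lift; for connected `S` it is unique up to a constant in `ℤ²`, so that its
derivatives of positive order depend on the map only. -/
def lift (f : SmoothMap p S) : E → ℝ × ℝ := f.exists_lift.choose

/-- The uniform distance of the maps (`k = 0`), or of their derivatives of order `k ≥ 1`. -/
def jetEDist (f g : SmoothMap p S) : ℕ → ℝ≥0∞
  | 0 => ⨆ x, edist (f x) (g x)
  | k + 1 => ⨆ z ∈ S, edist (iteratedFDerivWithin ℝ (k + 1) f.lift S z)
      (iteratedFDerivWithin ℝ (k + 1) g.lift S z)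

theorem jetEDist_self (f : SmoothMap p S) (k : ℕ) : jetEDist f f k = 0 := by
  cases k <;> simp [jetEDist]

theorem jetEDist_comm (f g : SmoothMap p S) (k : ℕ) : jetEDist f g k = jetEDist g f k := by
  cases k <;> simp [jetEDist, edist_comm]

theorem jetEDist_triangle (f g h : SmoothMap p S) (k : ℕ) :
    jetEDist f h k ≤ jetEDist f g k + jetEDist g h k := by
  cases k with
  | zero =>
    refine iSup_le fun x => (edist_triangle _ (g x) _).trans (add_le_add ?_ ?_)
    · exact le_iSup (fun x => edist (f x) (g x)) x
    · exact le_iSup (fun x => edist (g x) (h x)) x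
  | succ k =>
    refine iSup₂_le fun z hz =>
      (edist_triangle _ (iteratedFDerivWithin ℝ (k + 1) g.lift S z) _).trans (add_le_add ?_ ?_)
    · exact le_iSup₂ (f := fun z (_ : z ∈ S) => edist (iteratedFDerivWithin ℝ (k + 1) f.lift S z)
        (iteratedFDerivWithin ℝ (k + 1) g.lift S z)) z hz
    · exact le_iSup₂ (f := fun z (_ : z ∈ S) => edist (iteratedFDerivWithin ℝ (k + 1) g.lift S z)
        (iteratedFDerivWithin ℝ (k + 1) h.lift S z)) z hz

/-- The usual metric `∑ₖ 2⁻ᵏ min(1, ‖f - g‖ₖ)` of the `C^∞` topology: uniform convergence of the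
maps and of all their derivatives. -/
instance : PseudoEMetricSpace (SmoothMap p S) where
  edist f g := ∑' k : ℕ, (2⁻¹ : ℝ≥0∞) ^ k * min 1 (jetEDist f g k)
  edist_self f := by simp [jetEDist_self]
  edist_comm f g := by simp only [jetEDist_comm f g]
  edist_triangle f g h := by
    rw [← ENNReal.tsum_add]
    refine ENNReal.tsum_le_tsum fun k => ?_
    rw [← mul_add]
    gcongr
    refine (min_le_min_left 1 (jetEDist_triangle f g h k)).trans ?_
    rcases le_total 1 (jetEDist f g k) with h1 | h1
    · rw [min_eq_left h1]; exact (min_le_left _ _).trans le_self_add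
    rcases le_total 1 (jetEDist g h k) with h2 | h2
    · rw [min_eq_left h2]; exact (min_le_left _ _).trans le_add_self
    rw [min_eq_right h1, min_eq_right h2]
    exact min_le_right _ _

end SmoothMap

end SmoothMaps

/-- `C^∞((ℝ/ℤ)², (ℝ/ℤ)²)`. -/
abbrev SmoothTorusMap : Type := SmoothMap torusProj univ

/-- The covering `ℝ² × [0,1] → (ℝ/ℤ)² × [0,1]`. -/
def cylinderProj (z : (ℝ × ℝ) × ℝ) : Torus × Icc (0 : ℝ) 1 :=
  (torusProj z.1, projIcc 0 1 zero_le_one z.2)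

/-- `C^∞((ℝ/ℤ)² × [0,1], (ℝ/ℤ)²)`. -/
abbrev SmoothCylinderMap : Type := SmoothMap cylinderProj (univ ×ˢ Icc (0 : ℝ) 1)

/-! ## Area-preserving diffeomorphisms and isotopies -/

/-- `Diff^∞((ℝ/ℤ)², λ₂)`. -/
structure AreaDiffeo where
  toEquiv : Torus ≃ Torus
  smooth : ∃ g, IsSmoothLift torusProj univ toEquiv g
  smooth_symm : ∃ g, IsSmoothLift torusProj univ toEquiv.symm g
  measurePreserving : MeasurePreserving toEquiv volume volume

namespace AreaDiffeo

instance : CoeFun AreaDiffeo (fun _ => Torus → Torus) := ⟨fun T => T.toEquiv⟩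

/-- The underlying element of `C^∞((ℝ/ℤ)², (ℝ/ℤ)²)`. -/
def toSmooth (T : AreaDiffeo) : SmoothTorusMap := ⟨T, T.smooth⟩

theorem continuous_torusProj : Continuous torusProj :=
  ((AddCircle.continuous_mk' 1).comp continuous_fst).prodMk
    ((AddCircle.continuous_mk' 1).comp continuous_snd)

theorem isOpenQuotientMap_torusProj : IsOpenQuotientMap torusProj :=
  (QuotientAddGroup.isOpenQuotientMap_mk (N := AddSubgroup.zmultiples (1 : ℝ))).prodMap
    (QuotientAddGroup.isOpenQuotientMap_mk (N := AddSubgroup.zmultiples (1 : ℝ)))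

theorem continuous_of_lift {f : Torus → Torus} (h : ∃ g, IsSmoothLift torusProj univ f g) :
    Continuous f := by
  obtain ⟨g, hg⟩ := h
  refine isOpenQuotientMap_torusProj.isQuotientMap.continuous_iff.2 ?_
  have : f ∘ torusProj = torusProj ∘ g := by
    funext z
    exact (hg.lifts z (mem_univ z)).symm
  rw [this]
  exact continuous_torusProj.comp (contDiffOn_univ.1 hg.contDiffOn).continuous

theorem smooth_comp {f₁ f₂ : Torus → Torus} (h₁ : ∃ g, IsSmoothLift torusProj univ f₁ g)
    (h₂ : ∃ g, IsSmoothLift torusProj univ f₂ g) :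
    ∃ g, IsSmoothLift torusProj univ (f₁ ∘ f₂) g := by
  obtain ⟨g₁, h₁⟩ := h₁
  obtain ⟨g₂, h₂⟩ := h₂
  refine ⟨g₁ ∘ g₂, h₁.contDiffOn.comp h₂.contDiffOn (mapsTo_univ _ _), fun z hz => ?_⟩
  rw [Function.comp_apply, h₁.lifts _ (mem_univ _), h₂.lifts z hz, Function.comp_apply]

/-- The identity map. -/
def refl : AreaDiffeo where
  toEquiv := Equiv.refl _
  smooth := ⟨id, contDiffOn_id, fun _ _ => rfl⟩
  smooth_symm := ⟨id, contDiffOn_id, fun _ _ => rfl⟩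
  measurePreserving := MeasurePreserving.id _

/-- The composition `S ∘ T`. -/
def comp (S T : AreaDiffeo) : AreaDiffeo where
  toEquiv := T.toEquiv.trans S.toEquiv
  smooth := smooth_comp (f₁ := S.toEquiv) (f₂ := T.toEquiv) S.smooth T.smooth
  smooth_symm :=
    smooth_comp (f₁ := T.toEquiv.symm) (f₂ := S.toEquiv.symm) T.smooth_symm S.smooth_symm
  measurePreserving := S.measurePreserving.comp T.measurePreserving

/-- The inverse `T⁻¹`. -/
def symm (T : AreaDiffeo) : AreaDiffeo where
  toEquiv := T.toEquiv.symm
  smooth := T.smooth_symm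
  smooth_symm := T.smooth
  measurePreserving := by
    let e : Torus ≃ᵐ Torus :=
      { toEquiv := T.toEquiv
        measurable_toFun := (continuous_of_lift T.smooth).measurable
        measurable_invFun := (continuous_of_lift T.smooth_symm).measurable }
    exact MeasurePreserving.symm e T.measurePreserving

theorem smooth_rotation (a : ℝ) : ∃ g, IsSmoothLift torusProj univ
    (fun y : Torus => y + ((a : UnitAddCircle), (0 : UnitAddCircle))) g := by
  refine ⟨fun z => z + (a, 0), (contDiff_id.add contDiff_const).contDiffOn, fun z _ => ?_⟩
  simp [torusProj]

/-- The rotation `R_a (y₁, y₂) = (y₁ + a, y₂)`. -/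
def rotation (a : ℝ) : AreaDiffeo where
  toEquiv := Equiv.addRight ((a : UnitAddCircle), (0 : UnitAddCircle))
  smooth := smooth_rotation a
  smooth_symm := by
    have h := smooth_rotation (-a)
    have e : ⇑(Equiv.addRight (((a : UnitAddCircle), (0 : UnitAddCircle)) : Torus)).symm =
        fun y : Torus => y + (((-a : ℝ) : UnitAddCircle), (0 : UnitAddCircle)) := by
      funext y
      simp
    rw [e]
    exact h
  measurePreserving :=
    (measurePreserving_add_right (volume : Measure UnitAddCircle) (a : UnitAddCircle)).prod
      (measurePreserving_add_right (volume : Measure UnitAddCircle) (0 : UnitAddCircle))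

/-- `I` is a `C^∞` isotopy from the identity to `T` through area-preserving diffeomorphisms. -/
structure IsIsotopy (I : SmoothCylinderMap) (T : AreaDiffeo) : Prop where
  at_zero : ∀ y, I (y, 0) = y
  at_one : ∀ y, I (y, 1) = T y
  slice : ∀ t, ∃ D : AreaDiffeo, ∀ y, I (y, t) = D y

end AreaDiffeo

/-! ## The space of trees -/

/-- The trees on `ℕ` that contain branches of arbitrarily long length. -/
structure TreeSpace where
  carrier : Set (List ℕ)
  nil_mem : [] ∈ carrier
  prefix_mem : ∀ τ ∈ carrier, ∀ ρ, ρ <+: τ → ρ ∈ carrier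
  unbounded : ∀ n : ℕ, ∃ τ ∈ carrier, τ.length = n

open Classical in
/-- The topology induced by the product topology on `{0,1}^(ℕ^{<ℕ})`. -/
instance : TopologicalSpace TreeSpace :=
  TopologicalSpace.induced (fun (t : TreeSpace) (τ : List ℕ) => decide (τ ∈ t.carrier))
    inferInstance

/-- The index of the `n`-th element of the tree `t` (starting from `n = 0`) in the enumeration
`σ` of all finite sequences. -/
def TreeSpace.index (σ : ℕ ≃ List ℕ) (t : TreeSpace) (n : ℕ) : ℕ :=
  Nat.nth (fun m => σ m ∈ t.carrier) n

/-! ## Anosov–Katok realizations of circular systems, and the map from trees -/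

/-- The alphabet, of cardinality `2¹²`. -/
abbrev Letter : Type := Fin (2 ^ 12)

/-- The `i`-th block of length `m` of the word `w`. -/
def block (m : ℕ) (w : List Letter) (i : ℕ) : List Letter := (w.drop (i * m)).take m

/-- A construction sequence: `word n` lists the set `𝒲ₙ` of `n`-words, `len n` is their common
length, every `(n+1)`-word is a concatenation of `k n` many `n`-words, and every `n`-word occurs
`f n` times in it. -/
structure ConstructionSequence where
  word : ℕ → List (List Letter)
  len : ℕ → ℕ
  k : ℕ → ℕ
  f : ℕ → ℕ
  f_pos : ∀ n, 0 < f n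
  nodup : ∀ n, (word n).Nodup
  word_zero : ∀ w, w ∈ word 0 ↔ w.length = 1
  length_word : ∀ n, ∀ w ∈ word n, w.length = len n
  card_word : ∀ n, ∃ e : ℕ, (word n).length = 2 ^ e
  len_succ : ∀ n, len (n + 1) = k n * len n
  block_mem : ∀ n, ∀ w ∈ word (n + 1), ∀ i < k n, block (len n) w i ∈ word n
  uniform : ∀ n, ∀ w ∈ word (n + 1), ∀ v ∈ word n,
    {i : ℕ | i < k n ∧ block (len n) w i = v}.ncard = f n
  /-- A nontrivial shift of an `(n+1)`-word does not overlap an `(n+1)`-word in half of its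
  `n`-words or more. -/
  readable : ∀ n, ∀ w ∈ word (n + 1), ∀ w' ∈ word (n + 1), ∀ m i : ℕ,
    k n / 2 ≤ m → 1 ≤ i → i + m ≤ k n →
    ∃ j < m, block (len n) w (i + j) ≠ block (len n) w' j

/-- `qₙ` for the circular coefficients `(k, l)`: `q₀ = 1`, `qₙ₊₁ = kₙ lₙ qₙ²`. -/
def circQ (k l : ℕ → ℕ) : ℕ → ℕ
  | 0 => 1
  | n + 1 => k n * l n * circQ k l n ^ 2

/-- `pₙ` for the circular coefficients `(k, l)`: `p₀ = 0`, `pₙ₊₁ = pₙ kₙ lₙ qₙ + 1`. -/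
def circP (k l : ℕ → ℕ) : ℕ → ℕ
  | 0 => 0
  | n + 1 => circP k l n * k n * l n * circQ k l n + 1

/-- The rotation number `αₙ = pₙ / qₙ`. -/
def circAlpha (k l : ℕ → ℕ) (n : ℕ) : ℝ := (circP k l n : ℝ) / (circQ k l n : ℝ)

/-- The rectangle `[i/a, (i+1)/a) × [j/b, (j+1)/b)` in the torus. -/
def cell (a b i j : ℕ) : Set Torus :=
  torusProj '' (Ico ((i : ℝ) / a) (((i : ℝ) + 1) / a) ×ˢ Ico ((j : ℝ) / b) (((j : ℝ) + 1) / b))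

/-- `h` agrees, off a set of measure at most `δ`, with a permutation of rectangles that codes the
words `W` (listed as row labels) as concatenations of `k` words of length `m` out of `V`: of the
`k` rectangles into which `[i/q, (i+1)/q)` cuts the row of the `s`-th word of `W`, the `j`-th one
goes to the rectangle over `[i/q, (i+1)/q)` in the row of the `j`-th block of that word. -/
def Codes (h : AreaDiffeo) (δ : ℝ) (q k m : ℕ) (V W : List (List Letter)) : Prop :=
  ∃ D : Set Torus, volume D ≤ ENNReal.ofReal δ ∧
    ∀ i < q, ∀ j < k, ∀ s < W.length, ∀ r < V.length,
      V[r]? = (W[s]?).map (fun w => block m w j) →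
      h '' (cell (k * q) W.length (i * k + j) s \ D) ⊆ cell q V.length i r

/-- The conjugating maps `H₀ = id`, `Hₙ₊₁ = Hₙ ∘ hₙ₊₁`, where `h n` stands for `hₙ₊₁`. -/
def conjugator (h : ℕ → AreaDiffeo) : ℕ → AreaDiffeo
  | 0 => AreaDiffeo.refl
  | n + 1 => (conjugator h n).comp (h n)

/-- The `n`-th stage `Tₙ = Hₙ ∘ R_{αₙ} ∘ Hₙ⁻¹` of the Anosov–Katok construction. -/
def anosovKatokStage (k l : ℕ → ℕ) (h : ℕ → AreaDiffeo) (n : ℕ) : AreaDiffeo :=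
  ((conjugator h n).comp (AreaDiffeo.rotation (circAlpha k l n))).comp (conjugator h n).symm

/-- A smooth Anosov–Katok realization, with error bounds `ε`, of the circular system that belongs
to a construction sequence and to the coefficients `l`; `h n` is the map usually called `hₙ₊₁`. -/
structure AnosovKatok (ε : ℕ → ℝ) extends ConstructionSequence where
  l : ℕ → ℕ
  l_pos : ∀ n, 0 < l n
  h : ℕ → AreaDiffeo
  commute : ∀ n y, h n (AreaDiffeo.rotation (circAlpha k l n) y) =
    AreaDiffeo.rotation (circAlpha k l n) (h n y)
  codes : ∀ n, Codes (h n) (ε n) (circQ k l n) (k n) (len n) (word n) (word (n + 1))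
  /-- The coefficients `l` grow so fast that consecutive stages are close. -/
  close : ∀ n, edist (anosovKatokStage k l h n).toSmooth
    (anosovKatokStage k l h (n + 1)).toSmooth < ENNReal.ofReal (ε n)

/-- The stages `Tₙ` of a realization. -/
def AnosovKatok.stage {ε : ℕ → ℝ} (A : AnosovKatok ε) (n : ℕ) : AreaDiffeo :=
  anosovKatokStage A.k A.l A.h n

/-- The realizations are chosen for all trees such that everything that is used up to the `n`-th
stage depends only on the part of the tree among the sequences listed up to the tree's
`n`-th element. -/
structure TreeConstruction (σ : ℕ ≃ List ℕ) (ε : ℕ → ℝ) where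
  run : TreeSpace → AnosovKatok ε
  depends : ∀ (t t' : TreeSpace) (n : ℕ),
    (∀ m ≤ t.index σ n, (σ m ∈ t.carrier ↔ σ m ∈ t'.carrier)) →
    (∀ m ≤ n, (run t).word m = (run t').word m) ∧
    ∀ m < n, (run t).k m = (run t').k m ∧ (run t).l m = (run t').l m ∧ (run t).h m = (run t').h m

/-- `F` sends every tree to the `C^∞` limit of the stages of its realization. -/
def TreeConstruction.IsLimit {σ : ℕ ≃ List ℕ} {ε : ℕ → ℝ} (C : TreeConstruction σ ε)
    (F : TreeSpace → AreaDiffeo) : Prop :=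
  ∀ t, Tendsto (fun n => ((C.run t).stage n).toSmooth) atTop (𝓝 (F t).toSmooth)

end

/-! A stage `Tₙ = H R_α H⁻¹` is joined to the identity by the path `s ↦ H R_{sα} H⁻¹`. What remains
is to join the limit `F` to a single stage. If `F` is close enough to `Tₙ` in the `C¹` sense, then
`F Tₙ⁻¹` lifts to `z ↦ z + u z` with `u` periodic and `1/2`-Lipschitz, and such a map can be
deformed to the identity explicitly. Write `u = (u₁, u₂)`, `A_s = id + (0, (1 - θ s) u₂)` and `B_s =
id + (θ s u₁, u₂)`. Both are diffeomorphisms because `u` is a contraction, and their Jacobians agree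
because `det (I + Du) = 1` (`det_id_add_diagonalMap_eq`). Hence `B_s A_s⁻¹` preserves area. It is
the identity at `s = 0`, where `A = B`, and it is `id + u` at `s = 1`, where `A = id`
(`exists_areaPreserving_deformation`). Composing it with the path of conjugated rotations gives the
isotopy (`exists_continuous_isotopy`).

The closeness required depends on the size of `DTₙ⁻¹`. As `Tₙ → F` in `C¹` and `F` is a
diffeomorphism, these derivatives stay bounded, while the distance from `Tₙ` to `F` is at most a
tail of `∑ ε`. So some stage is good enough (`eventually_hasTameInverse`).

For continuity in the tree, the stage used is the first one that passes a test involving only that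
stage and the fixed sequence `ε`. A stage is a locally constant function of the tree, hence so are
the chosen index, conjugator and angle. The trees split into open pieces, on each of which all
limits are close to one and the same conjugated rotation. There the construction involves no further
choices, and it is continuous because `F` is continuous (`continuous_limit`,
`exists_continuous_isotopy_limit`).

The analysis takes place on lifts to the plane. `SmoothFamily` expresses continuous dependence on a
parameter in a form stable under composition and inversion; `smoothFamily_lift` and
`continuous_of_smoothFamily` translate from and to the `C^∞` metric. -/

open scoped NNReal

/-! ## Families of smooth maps with jointly continuous derivatives -/

section Family

universe u

variable {X : Type*} [TopologicalSpace X] {E F G K : Type u}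
  [NormedAddCommGroup E] [NormedSpace ℝ E] [NormedAddCommGroup F] [NormedSpace ℝ F]
  [NormedAddCommGroup G] [NormedSpace ℝ G] [NormedAddCommGroup K] [NormedSpace ℝ K]

/-- A family of smooth maps whose derivatives of order at most `k` are jointly continuous in the
parameter and the variable. -/
def CkFamily (k : ℕ) (f : X → E → F) : Prop :=
  (∀ x, ContDiff ℝ ∞ (f x)) ∧
    ∀ j ≤ k, Continuous (fun p : X × E => iteratedFDeriv ℝ j (f p.1) p.2)

/-- A family of smooth maps all of whose derivatives are jointly continuous. -/
def SmoothFamily (f : X → E → F) : Prop := ∀ k, CkFamily k f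

theorem CkFamily.mono {k j : ℕ} {f : X → E → F} (h : CkFamily k f) (hj : j ≤ k) : CkFamily j f :=
  ⟨h.1, fun i hi => h.2 i (hi.trans hj)⟩

theorem ckFamily_zero_iff {f : X → E → F} :
    CkFamily 0 f ↔ (∀ x, ContDiff ℝ ∞ (f x)) ∧ Continuous (fun p : X × E => f p.1 p.2) := by
  refine and_congr_right fun _ => ?_
  simp only [nonpos_iff_eq_zero, forall_eq, iteratedFDeriv_zero_eq_comp, Function.comp_apply]
  exact (continuousMultilinearCurryFin0 ℝ E F).symm.comp_continuous_iff

theorem CkFamily.continuous {k : ℕ} {f : X → E → F} (h : CkFamily k f) :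
    Continuous (fun p : X × E => f p.1 p.2) :=
  (ckFamily_zero_iff.1 (h.mono k.zero_le)).2

/-- Currying is an isometry, so derivatives of order `j + 1` of `f` are derivatives of order `j` of
`Df`. The closure properties below are proved with this by induction on the order, from the formula
for the first derivative. -/
theorem ckFamily_succ_iff {k : ℕ} {f : X → E → F} :
    CkFamily (k + 1) f ↔ CkFamily 0 f ∧ CkFamily k (fun x => fderiv ℝ (f x)) := by
  have key (j : ℕ) : Continuous (fun p : X × E => iteratedFDeriv ℝ (j + 1) (f p.1) p.2) ↔
      Continuous (fun p : X × E => iteratedFDeriv ℝ j (fderiv ℝ (f p.1)) p.2) := by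
    simp only [iteratedFDeriv_succ_eq_comp_right, Function.comp_apply]
    exact (continuousMultilinearCurryRightEquiv' ℝ j E F).symm.comp_continuous_iff
  constructor
  · intro h
    exact ⟨h.mono (Nat.zero_le _), fun x => (contDiff_infty_iff_fderiv.1 (h.1 x)).2,
      fun j hj => (key j).1 (h.2 _ (Nat.succ_le_succ hj))⟩
  · rintro ⟨h0, h1⟩
    refine ⟨h0.1, fun j hj => ?_⟩
    cases j with
    | zero => exact h0.2 0 le_rfl
    | succ j => exact (key j).2 (h1.2 j (Nat.le_of_succ_le_succ hj))

theorem CkFamily.differentiable {k : ℕ} {f : X → E → F} (h : CkFamily k f) (x : X) :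
    Differentiable ℝ (f x) :=
  (h.1 x).differentiable (by simp)

theorem CkFamily.add {k : ℕ} {f g : X → E → F} (hf : CkFamily k f) (hg : CkFamily k g) :
    CkFamily k (fun x z => f x z + g x z) := by
  refine ⟨fun x => (hf.1 x).add (hg.1 x), fun j hj => ?_⟩
  have : (fun p : X × E => iteratedFDeriv ℝ j (fun z => f p.1 z + g p.1 z) p.2) =
      fun p => iteratedFDeriv ℝ j (f p.1) p.2 + iteratedFDeriv ℝ j (g p.1) p.2 := by
    funext p
    exact iteratedFDeriv_add_apply ((hf.1 p.1).of_le (by exact_mod_cast le_top)).contDiffAt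
      ((hg.1 p.1).of_le (by exact_mod_cast le_top)).contDiffAt
  rw [this]
  exact (hf.2 j hj).add (hg.2 j hj)

theorem ckFamily_of_contDiff {f : E → F} (hf : ContDiff ℝ ∞ f) (k : ℕ) :
    CkFamily k (fun (_ : X) => f) :=
  ⟨fun _ => hf, fun j _ =>
    (hf.continuous_iteratedFDeriv (m := j) (by exact_mod_cast le_top)).comp continuous_snd⟩

/-- By the product rule, the derivative is a sum of two bilinear expressions of the same kind. Their
spaces differ from the original ones, so the induction must run over all target spaces, kept in one
universe. -/
theorem CkFamily.bilinear {k : ℕ} {f : X → E → F} {g : X → E → G} (B : F →L[ℝ] G →L[ℝ] K)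
    (hf : CkFamily k f) (hg : CkFamily k g) : CkFamily k (fun x z => B (f x z) (g x z)) := by
  induction k generalizing F G K with
  | zero =>
    exact ckFamily_zero_iff.2 ⟨fun x => B.isBoundedBilinearMap.contDiff.comp₂ (hf.1 x) (hg.1 x),
      B.isBoundedBilinearMap.continuous.comp₂ hf.continuous hg.continuous⟩
  | succ k ih =>
    refine ckFamily_succ_iff.2 ⟨ckFamily_zero_iff.2
      ⟨fun x => B.isBoundedBilinearMap.contDiff.comp₂ (hf.1 x) (hg.1 x),
      B.isBoundedBilinearMap.continuous.comp₂ hf.continuous hg.continuous⟩, ?_⟩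
    have : (fun x => fderiv ℝ (fun z => B (f x z) (g x z))) = fun x z =>
        B.precompR E (f x z) (fderiv ℝ (g x) z) + B.precompL E (fderiv ℝ (f x) z) (g x z) := by
      funext x z
      exact B.fderiv_of_bilinear (hf.differentiable x z) (hg.differentiable x z)
    rw [this]
    exact (ih (B.precompR E) (hf.mono k.le_succ) (ckFamily_succ_iff.1 hg).2).add
      (ih (B.precompL E) (ckFamily_succ_iff.1 hf).2 (hg.mono k.le_succ))

theorem CkFamily.comp {k : ℕ} {f : X → F → G} {g : X → E → F} (hf : CkFamily k f)
    (hg : CkFamily k g) : CkFamily k (fun x z => f x (g x z)) := by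
  induction k generalizing G with
  | zero =>
    exact ckFamily_zero_iff.2 ⟨fun x => (hf.1 x).comp (hg.1 x),
      hf.continuous.comp (continuous_fst.prodMk hg.continuous)⟩
  | succ k ih =>
    refine ckFamily_succ_iff.2 ⟨ckFamily_zero_iff.2 ⟨fun x => (hf.1 x).comp (hg.1 x),
      hf.continuous.comp (continuous_fst.prodMk hg.continuous)⟩, ?_⟩
    have : (fun x => fderiv ℝ (fun z => f x (g x z))) = fun x z =>
        ContinuousLinearMap.compL ℝ E F G (fderiv ℝ (f x) (g x z)) (fderiv ℝ (g x) z) := by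
      funext x z
      exact fderiv_comp z (hf.differentiable x _) (hg.differentiable x z)
    rw [this]
    exact (ih (ckFamily_succ_iff.1 hf).2 (hg.mono k.le_succ)).bilinear _
      (ckFamily_succ_iff.1 hg).2

/-- The derivative of `a⁻¹` is `-a⁻¹ (Da) a⁻¹`, which is bilinear in `a⁻¹` and in `Da`; one order
for the inverse thus yields the next. -/
theorem CkFamily.ringInverse [CompleteSpace F] {k : ℕ} {f : X → E → F →L[ℝ] F}
    (hf : CkFamily k f) (hu : ∀ x z, IsUnit (f x z)) :
    CkFamily k (fun x z => Ring.inverse (f x z)) := by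
  have h0 : CkFamily 0 (fun x z => Ring.inverse (f x z)) := by
    refine ckFamily_zero_iff.2 ⟨fun x => contDiff_iff_contDiffAt.2 fun z => ?_,
      continuous_iff_continuousAt.2 fun p => ?_⟩
    · obtain ⟨v, hv⟩ := hu x z
      exact ContDiffAt.comp z (hv ▸ contDiffAt_ringInverse ℝ v) (hf.1 x).contDiffAt
    · obtain ⟨v, hv⟩ := hu p.1 p.2
      exact ContinuousAt.comp (f := fun p : X × E => f p.1 p.2) (g := Ring.inverse)
        (hv ▸ NormedRing.inverse_continuousAt v) hf.continuous.continuousAt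
  induction k with
  | zero => exact h0
  | succ k ih =>
    refine ckFamily_succ_iff.2 ⟨h0, ?_⟩
    have hk := ih (hf.mono k.le_succ)
    have : (fun x => fderiv ℝ (fun z => Ring.inverse (f x z))) = fun x z =>
        ContinuousLinearMap.compL ℝ E (F →L[ℝ] F) (F →L[ℝ] F)
          (-(ContinuousLinearMap.mulLeftRight ℝ (F →L[ℝ] F) (Ring.inverse (f x z))
          (Ring.inverse (f x z)))) (fderiv ℝ (f x) z) := by
      funext x z
      obtain ⟨v, hv⟩ := hu x z
      have h1 := hasFDerivAt_ringInverse (𝕜 := ℝ) v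
      rw [← Ring.inverse_unit, hv] at h1
      exact (h1.comp z (hf.differentiable x z).hasFDerivAt).fderiv
    rw [this]
    exact CkFamily.bilinear (F := (F →L[ℝ] F) →L[ℝ] F →L[ℝ] F) (G := E →L[ℝ] F →L[ℝ] F)
      (K := E →L[ℝ] F →L[ℝ] F)
      (ContinuousLinearMap.compL ℝ E (F →L[ℝ] F) (F →L[ℝ] F))
      (hk.bilinear (-(ContinuousLinearMap.mulLeftRight ℝ (F →L[ℝ] F))) hk)
      (ckFamily_succ_iff.1 hf).2

/-- The inverses of a family of diffeomorphisms form a family of the same class. -/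
theorem CkFamily.inverse [CompleteSpace E] {k : ℕ} {f g : X → E → E} (hf : CkFamily k f)
    (hfg : ∀ x z, f x (g x z) = z) (hgf : ∀ x z, g x (f x z) = z)
    (hg : Continuous (fun p : X × E => g p.1 p.2)) (hu : ∀ x z, IsUnit (fderiv ℝ (f x) z)) :
    CkFamily k g := by
  have hsmooth (x : X) : ContDiff ℝ ∞ (g x) := by
    let e : E ≃ₜ E :=
      { toFun := f x
        invFun := g x
        left_inv := hgf x
        right_inv := hfg x
        continuous_toFun := (hf.1 x).continuous
        continuous_invFun := hg.comp (Continuous.prodMk_right x) }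
    have hd (z : E) : HasFDerivAt e
        (ContinuousLinearEquiv.unitsEquiv ℝ E (hu x z).unit : E →L[ℝ] E) z :=
      (hf.differentiable x z).hasFDerivAt
    exact e.contDiff_symm hd (hf.1 x)
  have h0 : CkFamily 0 g := ckFamily_zero_iff.2 ⟨hsmooth, hg⟩
  induction k with
  | zero => exact h0
  | succ k ih =>
    refine ckFamily_succ_iff.2 ⟨h0, ?_⟩
    -- `Dg = (Df ∘ g)⁻¹` involves only `g` itself, so control of `g` to order `k` gives control of
    -- `Dg` to order `k`.
    have : (fun x => fderiv ℝ (g x)) = fun x z => Ring.inverse (fderiv ℝ (f x) (g x z)) := by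
      funext x z
      have hdg := (hsmooth x).differentiable (by simp) z
      have h1 : fderiv ℝ (f x) (g x z) * fderiv ℝ (g x) z = 1 := by
        have := fderiv_comp z (hf.differentiable x (g x z)) hdg
        rw [show f x ∘ g x = id from funext (hfg x), fderiv_id] at this
        exact this.symm
      have h2 := hu x (g x z)
      calc fderiv ℝ (g x) z
          = Ring.inverse (fderiv ℝ (f x) (g x z)) * fderiv ℝ (f x) (g x z) *
              fderiv ℝ (g x) z := by rw [Ring.inverse_mul_cancel _ h2, one_mul]
        _ = _ := by rw [mul_assoc, h1, mul_one]
    rw [this]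
    exact ((ckFamily_succ_iff.1 hf).2.comp (ih (hf.mono k.le_succ))).ringInverse
      fun x z => hu x _

namespace SmoothFamily

theorem contDiff {f : X → E → F} (hf : SmoothFamily f) (x : X) : ContDiff ℝ ∞ (f x) := (hf 0).1 x

theorem continuous {f : X → E → F} (hf : SmoothFamily f) :
    Continuous (fun p : X × E => f p.1 p.2) := (hf 0).continuous

theorem const {f : E → F} (hf : ContDiff ℝ ∞ f) : SmoothFamily (fun (_ : X) => f) :=
  ckFamily_of_contDiff hf

theorem add {f g : X → E → F} (hf : SmoothFamily f) (hg : SmoothFamily g) :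
    SmoothFamily (fun x z => f x z + g x z) := fun k => (hf k).add (hg k)

theorem comp {f : X → F → G} {g : X → E → F} (hf : SmoothFamily f) (hg : SmoothFamily g) :
    SmoothFamily (fun x z => f x (g x z)) := fun k => (hf k).comp (hg k)

theorem bilinear {f : X → E → F} {g : X → E → G} (B : F →L[ℝ] G →L[ℝ] K)
    (hf : SmoothFamily f) (hg : SmoothFamily g) :
    SmoothFamily (fun x z => B (f x z) (g x z)) := fun k => (hf k).bilinear B (hg k)

theorem smul {E G : Type} [NormedAddCommGroup E] [NormedSpace ℝ E] [NormedAddCommGroup G]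
    [NormedSpace ℝ G] {f : X → E → ℝ} {g : X → E → G} (hf : SmoothFamily f) (hg : SmoothFamily g) :
    SmoothFamily (fun x z => f x z • g x z) :=
  hf.bilinear (ContinuousLinearMap.lsmul ℝ ℝ) hg

theorem clm_apply {f : X → E → F} (L : F →L[ℝ] G) (hf : SmoothFamily f) :
    SmoothFamily (fun x z => L (f x z)) :=
  (const L.contDiff).comp hf

theorem prodMk {f : X → E → F} {g : X → E → G} (hf : SmoothFamily f) (hg : SmoothFamily g) :
    SmoothFamily (fun x z => (f x z, g x z)) := by
  have := (hf.clm_apply (ContinuousLinearMap.inl ℝ F G)).add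
    (hg.clm_apply (ContinuousLinearMap.inr ℝ F G))
  simpa using this

end SmoothFamily

end Family

/-! ## The covering of the torus -/

theorem torusProj_add (z w : ℝ × ℝ) : torusProj (z + w) = torusProj z + torusProj w := rfl

theorem torusProj_sub (z w : ℝ × ℝ) : torusProj (z - w) = torusProj z - torusProj w := rfl

theorem torusProj_intCast (m n : ℤ) : torusProj ((m : ℝ), (n : ℝ)) = 0 := by
  have h (m : ℤ) : ((m : ℝ) : UnitAddCircle) = 0 :=
    (AddCircle.coe_eq_zero_iff 1).2 ⟨m, by simp⟩
  exact Prod.ext (h m) (h n)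

theorem torusProj_eq_iff {z w : ℝ × ℝ} :
    torusProj z = torusProj w ↔ ∃ m n : ℤ, z = w + ((m : ℝ), (n : ℝ)) := by
  constructor
  · intro h
    rw [← sub_eq_zero, ← torusProj_sub] at h
    obtain ⟨m, hm⟩ := (AddCircle.coe_eq_zero_iff 1).1 (congrArg Prod.fst h)
    obtain ⟨n, hn⟩ := (AddCircle.coe_eq_zero_iff 1).1 (congrArg Prod.snd h)
    refine ⟨m, n, Prod.ext ?_ ?_⟩
    · simp only [zsmul_eq_mul, mul_one, Prod.fst_sub] at hm
      simp [hm]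
    · simp only [zsmul_eq_mul, mul_one, Prod.snd_sub] at hn
      simp [hn]
  · rintro ⟨m, n, rfl⟩
    rw [torusProj_add, torusProj_intCast, add_zero]

theorem torusProj_add_intCast (z : ℝ × ℝ) (m n : ℤ) :
    torusProj (z + ((m : ℝ), (n : ℝ))) = torusProj z :=
  torusProj_eq_iff.2 ⟨m, n, rfl⟩

theorem torusProj_surjective : Function.Surjective torusProj :=
  AreaDiffeo.isOpenQuotientMap_torusProj.surjective

theorem norm_torusProj_eq {z : ℝ × ℝ} (hz : ‖z‖ ≤ 1 / 2) : ‖torusProj z‖ = ‖z‖ := by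
  have h {a : ℝ} (ha : ‖a‖ ≤ 1 / 2) : ‖(a : UnitAddCircle)‖ = ‖a‖ :=
    (AddCircle.norm_coe_eq_abs_iff 1 one_ne_zero).2 (by simpa using ha)
  have h1 := h ((norm_fst_le z).trans hz)
  have h2 := h ((norm_snd_le z).trans hz)
  rw [Prod.norm_def, Prod.norm_def]
  exact congrArg₂ max h1 h2

theorem norm_torusProj_le (z : ℝ × ℝ) : ‖torusProj z‖ ≤ ‖z‖ := by
  have h (a : ℝ) : ‖(a : UnitAddCircle)‖ ≤ ‖a‖ := by
    rw [UnitAddCircle.norm_eq]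
    simpa using round_le a 0
  exact max_le_max (h z.1) (h z.2)

theorem edist_torusProj_le (z w : ℝ × ℝ) : edist (torusProj z) (torusProj w) ≤ edist z w := by
  rw [edist_dist, edist_dist, dist_eq_norm, dist_eq_norm, ← torusProj_sub]
  exact ENNReal.ofReal_le_ofReal (norm_torusProj_le _)

/-! ## Smooth lifts -/

/-- The difference of two lifts is continuous with values in the discrete set `ℤ²`, hence constant
on a preconnected set. -/
theorem exists_eq_add_intCast_of_torusProj_eq {E : Type*} [TopologicalSpace E] {S : Set E}
    {g g' : E → ℝ × ℝ} (hS : IsPreconnected S) (hg : ContinuousOn g S)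
    (hg' : ContinuousOn g' S) (h : ∀ z ∈ S, torusProj (g z) = torusProj (g' z)) :
    ∃ m n : ℤ, ∀ z ∈ S, g z = g' z + ((m : ℝ), (n : ℝ)) := by
  rcases S.eq_empty_or_nonempty with rfl | ⟨z₀, hz₀⟩
  · exact ⟨0, 0, by simp⟩
  have hd : IsDiscrete (range ((↑) : ℤ → ℝ)) := by
    rw [isDiscrete_iff_discreteTopology]
    exact Int.isClosedEmbedding_coe_real.isEmbedding.toHomeomorph.symm.isEmbedding.discreteTopology
  have hm (z) (hz : z ∈ S) := torusProj_eq_iff.1 (h z hz)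
  have h1 (z) (hz : z ∈ S) : (g z - g' z).1 = (g z₀ - g' z₀).1 :=
    hS.constant_of_mapsTo hd (f := fun z => (g z - g' z).1)
      (continuous_fst.comp_continuousOn (hg.sub hg'))
      (fun z hz => by obtain ⟨m, n, e⟩ := hm z hz; exact ⟨m, by simp [e]⟩) hz hz₀
  have h2 (z) (hz : z ∈ S) : (g z - g' z).2 = (g z₀ - g' z₀).2 :=
    hS.constant_of_mapsTo hd (f := fun z => (g z - g' z).2)
      (continuous_snd.comp_continuousOn (hg.sub hg'))
      (fun z hz => by obtain ⟨m, n, e⟩ := hm z hz; exact ⟨n, by simp [e]⟩) hz hz₀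
  obtain ⟨m, n, e⟩ := hm z₀ hz₀
  refine ⟨m, n, fun z hz => ?_⟩
  have : g z - g' z = ((m : ℝ), (n : ℝ)) := by
    rw [Prod.ext (h1 z hz) (h2 z hz), e, add_sub_cancel_left]
  rw [← this, add_sub_cancel]

section Lifts

variable {E Y : Type*} [NormedAddCommGroup E] [NormedSpace ℝ E] {p : E → Y} {S : Set E}
  {f : Y → Torus} {g g' : E → ℝ × ℝ}

/-- The metric is computed from arbitrarily chosen lifts; this allows any convenient lift to be used
in their place. -/
theorem IsSmoothLift.iteratedFDerivWithin_eq (hg : IsSmoothLift p S f g)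
    (hg' : IsSmoothLift p S f g') (hS : IsPreconnected S) (hu : UniqueDiffOn ℝ S) (k : ℕ) {z : E}
    (hz : z ∈ S) :
    iteratedFDerivWithin ℝ (k + 1) g S z = iteratedFDerivWithin ℝ (k + 1) g' S z := by
  obtain ⟨m, n, h⟩ := exists_eq_add_intCast_of_torusProj_eq hS hg.contDiffOn.continuousOn
    hg'.contDiffOn.continuousOn fun z hz => (hg.lifts z hz).trans (hg'.lifts z hz).symm
  rw [iteratedFDerivWithin_congr h hz]
  have h1 := iteratedFDerivWithin_add_apply (i := k + 1) (x := z)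
    ((hg'.contDiffOn.contDiffWithinAt hz).of_le (by exact_mod_cast le_top))
    (contDiffWithinAt_const (c := (((m : ℝ), (n : ℝ)) : ℝ × ℝ))) hu hz
  refine h1.trans ?_
  rw [iteratedFDerivWithin_const_of_ne (Nat.succ_ne_zero k), Pi.zero_apply, add_zero]

end Lifts

/-! ## The metric of the smooth topology -/

namespace SmoothMap

variable {E Y : Type*} [NormedAddCommGroup E] [NormedSpace ℝ E] {p : E → Y} {S : Set E}

theorem isSmoothLift_lift (f : SmoothMap p S) : IsSmoothLift p S f f.lift :=
  f.exists_lift.choose_spec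

theorem edist_def (f g : SmoothMap p S) :
    edist f g = ∑' k : ℕ, (2⁻¹ : ℝ≥0∞) ^ k * min 1 (jetEDist f g k) := rfl

theorem jetEDist_lt {f g : SmoothMap p S} {k : ℕ} {c : ℝ≥0∞} (hc : c ≤ 1)
    (h : edist f g < 2⁻¹ ^ k * c) : jetEDist f g k < c := by
  rw [edist_def] at h
  have h1 := (ENNReal.le_tsum (f := fun k : ℕ =>
    (2⁻¹ : ℝ≥0∞) ^ k * min 1 (jetEDist f g k)) k).trans_lt h
  have h2 : min 1 (jetEDist f g k) < c := lt_of_mul_lt_mul_left' h1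
  rcases min_lt_iff.1 h2 with h3 | h3
  · exact absurd h3 hc.not_gt
  · exact h3

theorem eventually_jetEDist_lt (f : SmoothMap p S) (k : ℕ) {c : ℝ≥0∞} (hc : 0 < c) :
    ∀ᶠ g in 𝓝 f, jetEDist g f k < c := by
  have h0 : 0 < (2⁻¹ : ℝ≥0∞) ^ k * min c 1 :=
    ENNReal.mul_pos (pow_ne_zero _ (by simp)) (lt_min hc one_pos).ne'
  filter_upwards [Metric.eball_mem_nhds f h0] with g hg
  exact (jetEDist_lt (min_le_right _ _) hg).trans_le (min_le_left _ _)

theorem tendsto_of_jetEDist {ι : Type*} {l : Filter ι} {F : ι → SmoothMap p S} {f : SmoothMap p S}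
    (h : ∀ k, Tendsto (fun i => jetEDist (F i) f k) l (𝓝 0)) : Tendsto F l (𝓝 f) := by
  rw [tendsto_iff_edist_tendsto_0]
  let a (i : ι) (k : ℕ) : ℝ≥0∞ := (2⁻¹ : ℝ≥0∞) ^ k * min 1 (jetEDist (F i) f k)
  have ha (i k) : a i k ≤ 2⁻¹ ^ k := mul_le_of_le_one_right' (min_le_left _ _)
  have hfin (k : ℕ) : (2⁻¹ : ℝ≥0∞) ^ k ≠ ⊤ := ENNReal.pow_ne_top (by simp)
  have ha' (i k) : a i k ≠ ⊤ := ((ha i k).trans_lt (hfin k).lt_top).ne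
  have hsum : Summable (fun k : ℕ => (2⁻¹ : ℝ) ^ k) :=
    summable_geometric_of_lt_one (by norm_num) (by norm_num)
  -- Dominated convergence, with the weights `2⁻ᵏ` as the summable bound.
  have key : Tendsto (fun i => ∑' k, (a i k).toReal) l (𝓝 (∑' _ : ℕ, (0 : ℝ))) := by
    refine tendsto_tsum_of_dominated_convergence hsum (fun k => ?_) (.of_forall fun i k => ?_)
    · rw [← ENNReal.toReal_zero]
      refine (ENNReal.tendsto_toReal ENNReal.zero_ne_top).comp ?_
      have h1 : Tendsto (fun i => min 1 (jetEDist (F i) f k)) l (𝓝 0) :=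
        tendsto_of_tendsto_of_tendsto_of_le_of_le tendsto_const_nhds (h k)
          (fun _ => zero_le) (fun _ => min_le_right _ _)
      have := ENNReal.Tendsto.const_mul h1 (Or.inr (hfin k))
      rwa [mul_zero] at this
    · rw [Real.norm_of_nonneg ENNReal.toReal_nonneg]
      have := ENNReal.toReal_mono (hfin k) (ha i k)
      simpa using this
  rw [tsum_zero] at key
  have htop (i) : ∑' k, a i k ≠ ⊤ := by
    refine ((ENNReal.tsum_le_tsum (ha i)).trans_lt ?_).ne
    rw [ENNReal.tsum_geometric, ENNReal.one_sub_inv_two, inv_inv]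
    exact ENNReal.ofNat_lt_top
  have := (ENNReal.continuous_ofReal.tendsto 0).comp key
  rw [ENNReal.ofReal_zero] at this
  refine this.congr fun i => ?_
  rw [Function.comp_apply, ← ENNReal.tsum_toReal_eq (ha' i), ENNReal.ofReal_toReal (htop i)]
  rfl

end SmoothMap

theorem iteratedFDerivWithin_eq_of_contDiff {E F : Type*} [NormedAddCommGroup E] [NormedSpace ℝ E]
    [NormedAddCommGroup F] [NormedSpace ℝ F] {S : Set E} (hS : UniqueDiffOn ℝ S) {g : E → F}
    (hg : ContDiff ℝ ∞ g) (k : ℕ) {z : E} (hz : z ∈ S) :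
    iteratedFDerivWithin ℝ k g S z = iteratedFDeriv ℝ k g z :=
  iteratedFDerivWithin_eq_iteratedFDeriv hS (hg.of_le (by exact_mod_cast le_top)).contDiffAt hz

/-- A continuous family of smooth maps of the torus has a smooth family of lifts, if the lifts
depend continuously on the parameter at one point. -/
theorem smoothFamily_lift {X : Type*} [TopologicalSpace X] {f : X → SmoothTorusMap}
    (hf : Continuous f) {L : X → ℝ × ℝ → ℝ × ℝ}
    (hL : ∀ x, IsSmoothLift torusProj univ (f x) (L x)) {w : ℝ × ℝ}
    (hw : Continuous fun x => L x w) : SmoothFamily L := by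
  have hsm (x) : ContDiff ℝ ∞ (L x) := contDiffOn_univ.1 (hL x).contDiffOn
  -- The derivatives of positive order do not depend on the lift, so the metric controls them
  -- uniformly on the whole plane.
  have hjet (k : ℕ) (x₀ : X) {c : ℝ} (hc : 0 < c) : ∀ᶠ x in 𝓝 x₀, ∀ z,
      dist (iteratedFDeriv ℝ (k + 1) (L x) z) (iteratedFDeriv ℝ (k + 1) (L x₀) z) < c := by
    filter_upwards [hf.continuousAt ((f x₀).eventually_jetEDist_lt (k + 1)
      (ENNReal.ofReal_pos.2 hc))] with x hx z
    have h1 := (le_iSup₂ (f := fun z (_ : z ∈ univ) =>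
      edist (iteratedFDerivWithin ℝ (k + 1) (f x).lift univ z)
        (iteratedFDerivWithin ℝ (k + 1) (f x₀).lift univ z)) z (mem_univ z)).trans_lt hx
    rw [(f x).isSmoothLift_lift.iteratedFDerivWithin_eq (hL x) isPreconnected_univ uniqueDiffOn_univ
        k (mem_univ z),
      (f x₀).isSmoothLift_lift.iteratedFDerivWithin_eq (hL x₀) isPreconnected_univ
        uniqueDiffOn_univ k (mem_univ z), iteratedFDerivWithin_univ, iteratedFDerivWithin_univ] at h1
    rwa [edist_lt_ofReal] at h1
  refine fun k => ⟨hsm, fun j _ => continuous_iff_continuousAt.2 fun ⟨x₀, z₀⟩ => ?_⟩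
  cases j with
  | succ j =>
    rw [ContinuousAt, Metric.tendsto_nhds]
    intro c hc
    have hz : ∀ᶠ z in 𝓝 z₀, dist (iteratedFDeriv ℝ (j + 1) (L x₀) z)
        (iteratedFDeriv ℝ (j + 1) (L x₀) z₀) < c / 2 :=
      Metric.tendsto_nhds.1 (((hsm x₀).continuous_iteratedFDeriv (m := j + 1)
        (by exact_mod_cast le_top)).tendsto z₀) _ (half_pos hc)
    rw [nhds_prod_eq]
    filter_upwards [(hjet j x₀ (half_pos hc)).prod_mk hz] with q hq
    refine (dist_triangle _ (iteratedFDeriv ℝ (j + 1) (L x₀) q.2) _).trans_lt ?_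
    linarith [hq.1 q.2, hq.2]
  | zero =>
    simp only [iteratedFDeriv_zero_eq_comp, Function.comp_apply]
    refine (continuousMultilinearCurryFin0 ℝ (ℝ × ℝ) (ℝ × ℝ)).symm.continuous.continuousAt.comp
      (f := fun p : X × (ℝ × ℝ) => L p.1 p.2) ?_
    rw [ContinuousAt, Metric.tendsto_nhds]
    intro c hc
    have hz : ∀ᶠ z in 𝓝 z₀, dist (L x₀ z) (L x₀ z₀) < c / 3 :=
      Metric.tendsto_nhds.1 ((hsm x₀).continuous.tendsto z₀) _ (by positivity)
    have hz' : ∀ᶠ z in 𝓝 z₀, ‖z - w‖ < ‖z₀ - w‖ + 1 :=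
      (by fun_prop : Continuous fun z : ℝ × ℝ => ‖z - w‖).continuousAt.eventually_lt
        continuousAt_const (by simp)
    have hw' : ∀ᶠ x in 𝓝 x₀, dist (L x w) (L x₀ w) < c / 3 :=
      Metric.tendsto_nhds.1 (hw.tendsto x₀) _ (by positivity)
    have hN : 0 < ‖z₀ - w‖ + 1 := by positivity
    have hD := hjet 0 x₀ (c := c / 3 / (‖z₀ - w‖ + 1)) (by positivity)
    rw [nhds_prod_eq]
    filter_upwards [(hw'.and hD).prod_mk (hz.and hz')] with q hq
    obtain ⟨⟨h1, h2⟩, h3, h4⟩ := hq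
    have hdiff (x) : Differentiable ℝ (L x) := (hsm x).differentiable (by simp)
    -- Order zero is not controlled by the metric, since the lifts could jump by integer vectors.
    -- The mean value inequality carries the continuity from the base point `w` to nearby points of
    -- `z₀`.
    have hmv : ‖(L q.1 q.2 - L x₀ q.2) - (L q.1 w - L x₀ w)‖ ≤
        c / 3 / (‖z₀ - w‖ + 1) * ‖q.2 - w‖ := by
      refine convex_univ.norm_image_sub_le_of_norm_fderiv_le (𝕜 := ℝ)
        (f := fun z => L q.1 z - L x₀ z) (fun z _ => ((hdiff _).sub (hdiff _)) z) (fun z _ => ?_)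
        (mem_univ w) (mem_univ q.2)
      have h5 := (h2 z).le
      rw [dist_eq_norm, zero_add, ← iteratedFDeriv_sub_apply, norm_iteratedFDeriv_one] at h5
      · exact h5
      · exact ((hsm _).of_le (by exact_mod_cast le_top)).contDiffAt
      · exact ((hsm _).of_le (by exact_mod_cast le_top)).contDiffAt
    have hmv' : ‖(L q.1 q.2 - L x₀ q.2) - (L q.1 w - L x₀ w)‖ ≤ c / 3 :=
      hmv.trans <| (mul_le_mul_of_nonneg_left h4.le (by positivity)).trans
        (div_mul_cancel₀ _ hN.ne').le
    rw [dist_eq_norm] at h1 h3 ⊢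
    have e : L q.1 q.2 - L x₀ z₀ = ((L q.1 q.2 - L x₀ q.2) - (L q.1 w - L x₀ w)) +
        (L q.1 w - L x₀ w) + (L x₀ q.2 - L x₀ z₀) := by abel
    rw [e]
    exact (norm_add₃_le).trans_lt (by linarith)

/-! ## Maps on the cylinder -/

theorem uniqueDiffOn_cylinder : UniqueDiffOn ℝ ((univ : Set (ℝ × ℝ)) ×ˢ Icc (0 : ℝ) 1) :=
  uniqueDiffOn_univ.prod (uniqueDiffOn_Icc one_pos)

theorem isPreconnected_cylinder : IsPreconnected ((univ : Set (ℝ × ℝ)) ×ˢ Icc (0 : ℝ) 1) :=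
  isPreconnected_univ.prod isPreconnected_Icc

/-- An integer translate of a lift is again a lift of the same map, so it has the same derivatives
of positive order. -/
theorem IsSmoothLift.iteratedFDeriv_add_intCast {f : Torus × Icc (0 : ℝ) 1 → Torus}
    {L : (ℝ × ℝ) × ℝ → ℝ × ℝ} (h : IsSmoothLift cylinderProj (univ ×ˢ Icc (0 : ℝ) 1) f L)
    (hL : ContDiff ℝ ∞ L) (k : ℕ) (m n : ℤ) {z : (ℝ × ℝ) × ℝ}
    (hz : z ∈ (univ : Set (ℝ × ℝ)) ×ˢ Icc (0 : ℝ) 1) :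
    iteratedFDeriv ℝ (k + 1) L (z + (((m : ℝ), (n : ℝ)), 0)) = iteratedFDeriv ℝ (k + 1) L z := by
  have hL' : ContDiff ℝ ∞ fun z => L (z + (((m : ℝ), (n : ℝ)), 0)) :=
    hL.comp (contDiff_id.add contDiff_const)
  have h' : IsSmoothLift cylinderProj (univ ×ˢ Icc (0 : ℝ) 1) f
      fun z => L (z + (((m : ℝ), (n : ℝ)), 0)) := by
    refine ⟨hL'.contDiffOn, fun z hz => ?_⟩
    rw [h.lifts _ ⟨mem_univ _, by simpa using hz.2⟩]
    congr 1
    exact Prod.ext (torusProj_add_intCast z.1 m n) (by simp [cylinderProj])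
  have := h'.iteratedFDerivWithin_eq h isPreconnected_cylinder uniqueDiffOn_cylinder k hz
  rwa [iteratedFDerivWithin_eq_of_contDiff uniqueDiffOn_cylinder hL' _ hz,
    iteratedFDerivWithin_eq_of_contDiff uniqueDiffOn_cylinder hL _ hz,
    iteratedFDeriv_comp_add_right] at this

theorem exists_add_intCast_mem_Icc (z : ℝ × ℝ) :
    ∃ m n : ℤ, z + ((m : ℝ), (n : ℝ)) ∈ Icc (0 : ℝ) 1 ×ˢ Icc (0 : ℝ) 1 := by
  have h (a : ℝ) : a + ((-⌊a⌋ : ℤ) : ℝ) ∈ Icc (0 : ℝ) 1 := by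
    have e : a + ((-⌊a⌋ : ℤ) : ℝ) = Int.fract a := by
      rw [Int.cast_neg, ← sub_eq_add_neg]; rfl
    rw [e]
    exact ⟨Int.fract_nonneg a, (Int.fract_lt_one a).le⟩
  exact ⟨-⌊z.1⌋, -⌊z.2⌋, h z.1, h z.2⟩

/-- Maps on the cylinder whose lifts form a smooth family depend continuously on the parameter. -/
theorem continuous_of_smoothFamily {X : Type*} [TopologicalSpace X] {f : X → SmoothCylinderMap}
    {L : X → (ℝ × ℝ) × ℝ → ℝ × ℝ} (hL : SmoothFamily L)
    (h : ∀ x, IsSmoothLift cylinderProj (univ ×ˢ Icc (0 : ℝ) 1) (f x) (L x)) : Continuous f := by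
  refine continuous_iff_continuousAt.2 fun x₀ => SmoothMap.tendsto_of_jetEDist fun k => ?_
  let Q : Set ((ℝ × ℝ) × ℝ) := (Icc (0 : ℝ) 1 ×ˢ Icc (0 : ℝ) 1) ×ˢ Icc (0 : ℝ) 1
  have hQ : IsCompact Q := (isCompact_Icc.prod isCompact_Icc).prod isCompact_Icc
  -- Joint continuity becomes uniform on the compact fundamental domain `Q`; periodicity then
  -- extends the estimate to the whole cylinder.
  have hjet {c : ℝ≥0∞} (hc : 0 < c) : ∀ᶠ x in 𝓝 x₀, ∀ z ∈ Q,
      edist (iteratedFDeriv ℝ k (L x) z) (iteratedFDeriv ℝ k (L x₀) z) < c := by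
    refine hQ.eventually_forall_of_forall_eventually fun z _ => ?_
    have h1 := (hL k).2 k le_rfl
    have h2 : Continuous fun q : X × ((ℝ × ℝ) × ℝ) => edist (iteratedFDeriv ℝ k (L q.1) q.2)
        (iteratedFDeriv ℝ k (L x₀) q.2) :=
      h1.edist (h1.comp (continuous_const.prodMk continuous_snd))
    exact h2.continuousAt.eventually_lt continuousAt_const (by simpa using hc)
  rw [ENNReal.tendsto_nhds_zero]
  intro c hc
  filter_upwards [hjet hc] with x hx
  cases k with
  | zero =>
    refine iSup_le fun ⟨y, t⟩ => ?_
    obtain ⟨z, rfl⟩ := torusProj_surjective y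
    obtain ⟨m, n, hmn⟩ := exists_add_intCast_mem_Icc z
    have e : (torusProj z, t) = cylinderProj (z + ((m : ℝ), (n : ℝ)), t) :=
      Prod.ext (torusProj_add_intCast z m n).symm (projIcc_val zero_le_one t).symm
    have hS : (z + ((m : ℝ), (n : ℝ)), (t : ℝ)) ∈ (univ : Set (ℝ × ℝ)) ×ˢ Icc (0 : ℝ) 1 :=
      ⟨mem_univ _, t.2⟩
    rw [e, ← (h x).lifts _ hS, ← (h x₀).lifts _ hS]
    refine (edist_torusProj_le _ _).trans ?_
    have := hx (z + ((m : ℝ), (n : ℝ)), (t : ℝ)) ⟨hmn, t.2⟩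
    simp only [iteratedFDeriv_zero_eq_comp, Function.comp_apply] at this
    rw [LinearIsometryEquiv.edist_map] at this
    exact this.le
  | succ k =>
    refine iSup₂_le fun z hz => ?_
    rw [(f x).isSmoothLift_lift.iteratedFDerivWithin_eq (h x) isPreconnected_cylinder
        uniqueDiffOn_cylinder k hz,
      (f x₀).isSmoothLift_lift.iteratedFDerivWithin_eq (h x₀) isPreconnected_cylinder
        uniqueDiffOn_cylinder k hz,
      iteratedFDerivWithin_eq_of_contDiff uniqueDiffOn_cylinder (hL.contDiff x) _ hz,
      iteratedFDerivWithin_eq_of_contDiff uniqueDiffOn_cylinder (hL.contDiff x₀) _ hz]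
    obtain ⟨m, n, hmn⟩ := exists_add_intCast_mem_Icc z.1
    rw [← (h x).iteratedFDeriv_add_intCast (hL.contDiff x) k m n hz,
      ← (h x₀).iteratedFDeriv_add_intCast (hL.contDiff x₀) k m n hz]
    exact (hx _ ⟨hmn, by simpa using hz.2⟩).le

/-! ## Lebesgue measure on the torus and on the plane -/

/-- The lattice `ℤ²` of deck transformations. -/
def deckLattice : AddSubgroup (ℝ × ℝ) :=
  (AddSubgroup.zmultiples (1 : ℝ)).prod (AddSubgroup.zmultiples (1 : ℝ))

theorem mem_deckLattice_iff {z : ℝ × ℝ} : z ∈ deckLattice ↔ torusProj z = 0 := by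
  rw [deckLattice, AddSubgroup.mem_prod, Prod.ext_iff]
  exact and_congr (QuotientAddGroup.eq_zero_iff _).symm (QuotientAddGroup.eq_zero_iff _).symm

/-- The square `(a₁, a₁ + 1] × (a₂, a₂ + 1]`. -/
def unitSquare (a : ℝ × ℝ) : Set (ℝ × ℝ) := Ioc a.1 (a.1 + 1) ×ˢ Ioc a.2 (a.2 + 1)

theorem measurableSet_unitSquare (a : ℝ × ℝ) : MeasurableSet (unitSquare a) :=
  measurableSet_Ioc.prod measurableSet_Ioc

theorem unitSquare_mem_nhds (z : ℝ × ℝ) : unitSquare (z - (1 / 2, 1 / 2)) ∈ 𝓝 z := by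
  refine prod_mem_nhds (Ioc_mem_nhds ?_ ?_) (Ioc_mem_nhds ?_ ?_) <;>
    simp only [Prod.fst_sub, Prod.snd_sub] <;> linarith

theorem measurePreserving_torusProj (a : ℝ × ℝ) :
    MeasurePreserving torusProj (volume.restrict (unitSquare a)) volume := by
  have := (UnitAddCircle.measurePreserving_mk a.1).prod (UnitAddCircle.measurePreserving_mk a.2)
  rwa [Measure.prod_restrict] at this

theorem torusProj_injOn_unitSquare (a : ℝ × ℝ) : InjOn torusProj (unitSquare a) := by
  intro z hz w hw h
  exact Prod.ext ((AddCircle.coe_eq_coe_iff_of_mem_Ioc (p := (1 : ℝ)) hz.1 hw.1).1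
    (congrArg Prod.fst h)) ((AddCircle.coe_eq_coe_iff_of_mem_Ioc (p := (1 : ℝ)) hz.2 hw.2).1
    (congrArg Prod.snd h))

theorem volume_torusProj_image {a : ℝ × ℝ} {A : Set (ℝ × ℝ)} (hA : IsOpen A)
    (hAa : A ⊆ unitSquare a) : volume (torusProj '' A) = volume A := by
  have hO : MeasurableSet (torusProj '' A) :=
    (AreaDiffeo.isOpenQuotientMap_torusProj.isOpenMap A hA).measurableSet
  rw [← (measurePreserving_torusProj a).measure_preimage hO.nullMeasurableSet,
    Measure.restrict_apply ((measurePreserving_torusProj a).measurable hO)]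
  congr 1
  ext z
  constructor
  · rintro ⟨⟨w, hw, e⟩, hz⟩
    rwa [← torusProj_injOn_unitSquare a (hAa hw) hz e]
  · exact fun hz => ⟨⟨z, hz, rfl⟩, hAa hz⟩

theorem isAddFundamentalDomain_unitSquare (a : ℝ × ℝ) :
    IsAddFundamentalDomain deckLattice (unitSquare a) := by
  refine IsAddFundamentalDomain.mk' (measurableSet_unitSquare a).nullMeasurableSet fun z => ?_
  obtain ⟨m, hm, hm'⟩ := existsUnique_add_zsmul_mem_Ioc one_pos z.1 a.1
  obtain ⟨n, hn, hn'⟩ := existsUnique_add_zsmul_mem_Ioc one_pos z.2 a.2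
  refine ⟨⟨(m • 1, n • 1), ⟨⟨m, rfl⟩, ⟨n, rfl⟩⟩⟩, ⟨?_, ?_⟩, ?_⟩
  · simpa [AddSubgroup.vadd_def, add_comm] using hm
  · simpa [AddSubgroup.vadd_def, add_comm] using hn
  · rintro ⟨⟨x, y⟩, ⟨⟨i, hi⟩, ⟨j, hj⟩⟩⟩ ⟨h1, h2⟩
    obtain rfl : i • (1 : ℝ) = x := hi
    obtain rfl : j • (1 : ℝ) = y := hj
    have e1 := hm' i (by simpa [AddSubgroup.vadd_def, add_comm] using h1)
    have e2 := hn' j (by simpa [AddSubgroup.vadd_def, add_comm] using h2)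
    subst e1 e2
    rfl

instance : Countable deckLattice := by
  have h : (deckLattice : Set (ℝ × ℝ)) ⊆ range fun p : ℤ × ℤ => ((p.1 : ℝ), (p.2 : ℝ)) := by
    rintro ⟨x, y⟩ ⟨⟨i, hi⟩, ⟨j, hj⟩⟩
    obtain rfl : i • (1 : ℝ) = x := hi
    obtain rfl : j • (1 : ℝ) = y := hj
    exact ⟨(i, j), by simp⟩
  exact ((countable_range _).mono h).to_subtype

instance : VAddInvariantMeasure deckLattice (ℝ × ℝ) volume :=
  ⟨fun c _ _ => measure_preimage_add volume (c : ℝ × ℝ) _⟩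

/-- A map of the torus preserves the area if a lift homotopic to the identity does. -/
theorem measurePreserving_of_lift {f : Torus → Torus} (hf : Measurable f) (g : (ℝ × ℝ) ≃ₜ (ℝ × ℝ))
    (hg : MeasurePreserving g volume volume) (hlift : ∀ z, torusProj (g z) = f (torusProj z))
    (hper : ∀ z, ∀ c ∈ deckLattice, g (c + z) = c + g z) : MeasurePreserving f volume volume := by
  refine ⟨hf, Measure.ext fun B hB => ?_⟩
  have hp := measurePreserving_torusProj 0
  have hD := isAddFundamentalDomain_unitSquare 0
  -- The unit square and its image under `g` are both fundamental domains, and a lattice-invariant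
  -- set meets any two of these in the same measure.
  have hgD : IsAddFundamentalDomain deckLattice (g '' unitSquare 0) :=
    hD.image_of_equiv g.toEquiv (hg.symm g.toMeasurableEquiv).quasiMeasurePreserving
      (Equiv.refl _) fun c z => hper z c c.2
  have hB' : MeasurableSet (torusProj ⁻¹' B) := hp.measurable hB
  have hgm : MeasurableSet (g '' unitSquare 0) :=
    g.toMeasurableEquiv.measurableSet_image.2 (measurableSet_unitSquare 0)
  rw [Measure.map_apply hf hB, ← hp.measure_preimage hB.nullMeasurableSet,
    ← hp.measure_preimage (hf hB).nullMeasurableSet, Measure.restrict_apply hB',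
    Measure.restrict_apply (hp.measurable (hf hB)), hD.measure_set_eq hgD hB' fun c => ?_,
    ← hg.measure_preimage (hB'.inter hgm).nullMeasurableSet]
  · congr 1
    ext z
    simp [hlift]
  · ext z
    change torusProj (c + z) ∈ B ↔ torusProj z ∈ B
    rw [torusProj_add, mem_deckLattice_iff.1 c.2, zero_add]

theorem measurePreserving_of_abs_det_eq_one (g : (ℝ × ℝ) ≃ₜ (ℝ × ℝ)) (hg : Differentiable ℝ g)
    (hdet : ∀ z, |(fderiv ℝ g z).det| = 1) : MeasurePreserving g volume volume := by
  have h : MeasurePreserving g.symm volume volume := by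
    refine ⟨g.symm.continuous.measurable, Measure.ext fun s hs => ?_⟩
    rw [Measure.map_apply g.symm.continuous.measurable hs, ← g.image_eq_preimage_symm,
      ← lintegral_abs_det_fderiv_eq_addHaar_image volume hs
        (fun z _ => (hg z).hasFDerivAt.hasFDerivWithinAt) g.injective.injOn]
    simp [hdet]
  exact h.symm g.symm.toMeasurableEquiv

/-- If `J z` differed from `1`, then by continuity `J` would stay on one side of a constant `c ≠ 1`
on a small ball, and integrating over the ball gives a contradiction. -/
theorem eq_one_of_setLIntegral_eq_volume {J : ℝ × ℝ → ℝ} (hJ : Continuous J) {z : ℝ × ℝ}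
    {U : Set (ℝ × ℝ)} (hU : U ∈ 𝓝 z)
    (h : ∀ A ⊆ U, IsOpen A → ∫⁻ x in A, ENNReal.ofReal (J x) = volume A) : J z = 1 := by
  have hsmall (V : Set (ℝ × ℝ)) (hV : V ∈ 𝓝 z) :
      ∃ A ⊆ V, A ⊆ U ∧ IsOpen A ∧ volume A ≠ 0 ∧ volume A ≠ ⊤ := by
    obtain ⟨r, hr, hsub⟩ := Metric.mem_nhds_iff.1 (inter_mem hV hU)
    exact ⟨Metric.ball z r, hsub.trans inter_subset_left, hsub.trans inter_subset_right,
      Metric.isOpen_ball, (Metric.measure_ball_pos volume z hr).ne', measure_ball_lt_top.ne⟩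
  rcases lt_trichotomy (J z) 1 with hlt | heq | hgt
  · exfalso
    obtain ⟨c, hc, hc1⟩ := exists_between hlt
    obtain ⟨A, hAV, hAU, hA, h0, ht⟩ := hsmall {x | J x < c} (hJ.continuousAt.eventually_lt
      continuousAt_const hc)
    have h1 : volume A ≤ ENNReal.ofReal c * volume A := by
      calc volume A = ∫⁻ x in A, ENNReal.ofReal (J x) := (h A hAU hA).symm
        _ ≤ ∫⁻ _ in A, ENNReal.ofReal c := setLIntegral_mono measurable_const
            fun x hx => ENNReal.ofReal_le_ofReal (hAV hx).le
        _ = _ := setLIntegral_const _ _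
    have h2 : ENNReal.ofReal c * volume A < 1 * volume A :=
      ENNReal.mul_lt_mul_left h0 ht (by simpa using hc1)
    rw [one_mul] at h2
    exact h2.not_ge h1
  · exact heq
  · exfalso
    obtain ⟨c, hc1, hc⟩ := exists_between hgt
    obtain ⟨A, hAV, hAU, hA, h0, ht⟩ := hsmall {x | c < J x} (continuousAt_const.eventually_lt
      hJ.continuousAt hc)
    have h1 : ENNReal.ofReal c * volume A ≤ volume A := by
      calc _ = ∫⁻ _ in A, ENNReal.ofReal c := (setLIntegral_const _ _).symm
        _ ≤ ∫⁻ x in A, ENNReal.ofReal (J x) := setLIntegral_mono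
            (ENNReal.measurable_ofReal.comp hJ.measurable)
            fun x hx => ENNReal.ofReal_le_ofReal (hAV hx).le
        _ = _ := h A hAU hA
    have h2 : 1 * volume A < ENNReal.ofReal c * volume A :=
      ENNReal.mul_lt_mul_left h0 ht (by simpa using hc1)
    rw [one_mul] at h2
    exact h2.not_ge h1

/-- The lifts of area-preserving diffeomorphisms have Jacobian `±1`. -/
theorem AreaDiffeo.abs_det_fderiv_eq_one (T : AreaDiffeo) (g : (ℝ × ℝ) ≃ₜ (ℝ × ℝ))
    (hg : ContDiff ℝ ∞ g) (hlift : ∀ z, torusProj (g z) = T (torusProj z)) (z : ℝ × ℝ) :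
    |(fderiv ℝ g z).det| = 1 := by
  have hcont : Continuous fun z => |(fderiv ℝ g z).det| :=
    (ContinuousLinearMap.continuous_det.comp (hg.continuous_fderiv (by simp))).abs
  -- The test sets `A` are so small that the covering is injective both on `A` and on `g '' A`;
  -- areas can then be compared on the torus.
  refine eq_one_of_setLIntegral_eq_volume hcont
    (inter_mem (unitSquare_mem_nhds z) (g.continuous.continuousAt (unitSquare_mem_nhds (g z))))
    fun A hAU hA => ?_
  rw [lintegral_abs_det_fderiv_eq_addHaar_image volume hA.measurableSet
    (fun z _ => (hg.differentiable (by simp) z).hasFDerivAt.hasFDerivWithinAt) g.injective.injOn]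
  have hgA : IsOpen (g '' A) := g.isOpenMap A hA
  rw [← volume_torusProj_image hA (hAU.trans inter_subset_left),
    ← volume_torusProj_image hgA (image_subset_iff.2 (hAU.trans inter_subset_right))]
  have hO : MeasurableSet (torusProj '' (g '' A)) :=
    (isOpenQuotientMap_torusProj.isOpenMap _ hgA).measurableSet
  rw [← T.measurePreserving.measure_preimage hO.nullMeasurableSet]
  congr 1
  ext y
  simp only [mem_preimage, mem_image, exists_exists_and_eq_and, hlift]
  exact exists_congr fun w => and_congr_right fun _ => T.toEquiv.injective.eq_iff

/-! ## Perturbations of the identity -/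

section NearIdentity

variable {E P : Type} [NormedAddCommGroup E] [NormedSpace ℝ E] [FiniteDimensional ℝ E]
  [NormedAddCommGroup P] [NormedSpace ℝ P] [FiniteDimensional ℝ P]

theorem approximatesLinearOn_id_add {E : Type*} [NormedAddCommGroup E] [NormedSpace ℝ E]
    {φ : E → E} (hφ : LipschitzWith (1 / 2) φ) :
    ApproximatesLinearOn (fun z => z + φ z) (ContinuousLinearEquiv.refl ℝ E : E →L[ℝ] E) univ
      (1 / 2) := by
  rw [ApproximatesLinearOn.approximatesLinearOn_iff_lipschitzOnWith, lipschitzOnWith_univ]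
  have e : ((fun z => z + φ z) - ⇑(ContinuousLinearEquiv.refl ℝ E : E →L[ℝ] E)) = φ := by
    funext z
    simp
  rwa [e]

/-- The homeomorphism `z ↦ z + φ z` for a contraction `φ`. -/
noncomputable def idAddHomeomorph (φ : E → E) (hφ : LipschitzWith (1 / 2) φ) : E ≃ₜ E :=
  haveI := FiniteDimensional.complete ℝ E
  (approximatesLinearOn_id_add hφ).toHomeomorph _ (by
    rcases subsingleton_or_nontrivial E with h | h
    · exact Or.inl h
    · refine Or.inr ?_
      have h1 : ‖((ContinuousLinearEquiv.refl ℝ E).symm : E →L[ℝ] E)‖₊ = 1 :=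
        NNReal.eq (ContinuousLinearMap.norm_id (𝕜 := ℝ))
      rw [h1, inv_one, ← NNReal.coe_lt_coe]
      norm_num)

/-- This is injectivity of `id + φ` with the uniform constant `2`; it yields joint continuity of the
inverses in the point and the parameters. -/
theorem norm_sub_le_of_lipschitz {E : Type*} [NormedAddCommGroup E] {φ : E → E}
    (hφ : LipschitzWith (1 / 2) φ) (z w : E) :
    ‖z - w‖ ≤ 2 * ‖(z + φ z) - (w + φ w)‖ := by
  have h1 := hφ.norm_sub_le z w
  have e : z - w = ((z + φ z) - (w + φ w)) - (φ z - φ w) := by abel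
  have h2 := norm_sub_le ((z + φ z) - (w + φ w)) (φ z - φ w)
  rw [← e] at h2
  norm_num at h1
  linarith

/-- The inverses of a smooth family of perturbations of the identity form a smooth family. -/
theorem exists_smoothFamily_inverse {X : Type*} [TopologicalSpace X] {φ : X → E × P → E}
    (hφ : SmoothFamily φ) (hlip : ∀ x p, LipschitzWith (1 / 2) fun z => φ x (z, p)) :
    ∃ ψ : X → E × P → E, SmoothFamily ψ ∧
      (∀ x z p, ψ x (z, p) + φ x (ψ x (z, p), p) = z) ∧
      ∀ x z p, ψ x (z + φ x (z, p), p) = z := by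
  have := FiniteDimensional.complete ℝ E
  have := FiniteDimensional.complete ℝ P
  let ψ : X → E × P → E := fun x q => (idAddHomeomorph _ (hlip x q.2)).symm q.1
  have h1 (x z p) : ψ x (z, p) + φ x (ψ x (z, p), p) = z :=
    (idAddHomeomorph _ (hlip x p)).apply_symm_apply z
  have h2 (x z p) : ψ x (z + φ x (z, p), p) = z :=
    (idAddHomeomorph _ (hlip x p)).symm_apply_apply z
  have hψ : Continuous fun q : X × (E × P) => ψ q.1 q.2 := by
    refine continuous_iff_continuousAt.2 fun ⟨x₀, z₀, p₀⟩ => ?_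
    have hc : Continuous fun q : X × (E × P) =>
        2 * ‖q.2.1 - (ψ x₀ (z₀, p₀) + φ q.1 (ψ x₀ (z₀, p₀), q.2.2))‖ := by
      have := hφ.continuous.comp (continuous_fst.prodMk (continuous_const.prodMk
        (continuous_snd.comp continuous_snd)) :
          Continuous fun q : X × (E × P) => (q.1, (ψ x₀ (z₀, p₀), q.2.2)))
      exact continuous_const.mul
        ((continuous_fst.comp continuous_snd).sub (continuous_const.add this)).norm
    have ht := hc.tendsto (x₀, z₀, p₀)
    simp only [h1, sub_self, norm_zero, mul_zero] at ht
    refine tendsto_iff_norm_sub_tendsto_zero.2 (squeeze_zero (fun _ => norm_nonneg _) ?_ ht)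
    rintro ⟨x, z, p⟩
    have := norm_sub_le_of_lipschitz (hlip x p) (ψ x (z, p)) (ψ x₀ (z₀, p₀))
    rwa [h1] at this
  -- Keeping the smooth parameter `p` as a second coordinate gives a diffeomorphism of `E × P`, so
  -- the inverse is smooth in `p` as well.
  have hf : SmoothFamily fun x (q : E × P) => (q.1 + φ x q, q.2) :=
    ((SmoothFamily.const contDiff_fst).add hφ).prodMk (SmoothFamily.const contDiff_snd)
  have hinv : SmoothFamily fun x (q : E × P) => (ψ x q, q.2) := by
    refine fun k => (hf k).inverse (fun x q => Prod.ext (h1 x q.1 q.2) rfl)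
      (fun x q => Prod.ext (h2 x q.1 q.2) rfl)
      (hψ.prodMk (continuous_snd.comp continuous_snd)) fun x q => ?_
    have hd : HasFDerivAt (φ x) (fderiv ℝ (φ x) q) q :=
      ((hφ.contDiff x).differentiable (by simp) q).hasFDerivAt
    have hd' : HasFDerivAt (fun q : E × P => (q.1 + φ x q, q.2))
        ((ContinuousLinearMap.fst ℝ E P + fderiv ℝ (φ x) q).prod
          (ContinuousLinearMap.snd ℝ E P)) q :=
      (hasFDerivAt_fst.add hd).prodMk hasFDerivAt_snd
    -- The partial derivative in `z` inherits the Lipschitz constant, so a vector `(w, 0)` of the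
    -- kernel satisfies `‖w‖ ≤ ‖w‖ / 2`.
    have hnorm : ‖(fderiv ℝ (φ x) q).comp (ContinuousLinearMap.inl ℝ E P)‖ ≤ ((1 / 2 : ℝ≥0) : ℝ) :=
      HasFDerivAt.le_of_lipschitz (x₀ := q.1)
        (HasFDerivAt.comp q.1 (f := fun z => (z, q.2)) hd (hasFDerivAt_prodMk_left q.1 q.2))
        (hlip x q.2)
    rw [hd'.fderiv, ContinuousLinearMap.isUnit_iff_bijective]
    have hinj : Function.Injective ((ContinuousLinearMap.fst ℝ E P + fderiv ℝ (φ x) q).prod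
          (ContinuousLinearMap.snd ℝ E P)) := by
      rw [injective_iff_map_eq_zero]
      rintro ⟨w, t⟩ h
      obtain rfl : t = 0 := congrArg Prod.snd h
      have h3 : w + fderiv ℝ (φ x) q (w, 0) = 0 := congrArg Prod.fst h
      have h4 : ‖fderiv ℝ (φ x) q (w, 0)‖ ≤ ((1 / 2 : ℝ≥0) : ℝ) * ‖w‖ :=
        ContinuousLinearMap.le_of_opNorm_le _ hnorm w
      rw [eq_neg_of_add_eq_zero_right h3, norm_neg] at h4
      norm_num at h4
      have h5 : ‖w‖ = 0 := le_antisymm (by linarith) (norm_nonneg w)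
      rw [norm_eq_zero.1 h5]
      rfl
    exact ⟨hinj, LinearMap.injective_iff_surjective.1 hinj⟩
  exact ⟨ψ, hinv.clm_apply (ContinuousLinearMap.fst ℝ E P), h1, h2⟩

end NearIdentity

/-! ## Area-preserving deformations of a map close to the identity -/

theorem det_prod_eq (L : ℝ × ℝ →L[ℝ] ℝ × ℝ) :
    L.det = (L (1, 0)).1 * (L (0, 1)).2 - (L (0, 1)).1 * (L (1, 0)).2 := by
  rw [ContinuousLinearMap.det, ← LinearMap.det_toMatrix (Module.Basis.finTwoProd ℝ),
    Matrix.det_fin_two]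
  simp [LinearMap.toMatrix_apply]

/-- The linear map `(a, b) ↦ (s a, t b)`. -/
noncomputable def diagonalMap (s t : ℝ) : ℝ × ℝ →L[ℝ] ℝ × ℝ :=
  (s • ContinuousLinearMap.fst ℝ ℝ ℝ).prod (t • ContinuousLinearMap.snd ℝ ℝ ℝ)

@[simp]
theorem diagonalMap_apply (s t : ℝ) (z : ℝ × ℝ) : diagonalMap s t z = (s * z.1, t * z.2) := rfl

theorem norm_diagonalMap_apply_le {s t : ℝ} (hs : s ∈ Icc (0 : ℝ) 1) (ht : t ∈ Icc (0 : ℝ) 1)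
    (z : ℝ × ℝ) : ‖diagonalMap s t z‖ ≤ ‖z‖ := by
  refine max_le_max ?_ ?_ <;> dsimp only [diagonalMap_apply]
  · rw [norm_mul, Real.norm_of_nonneg hs.1]
    exact mul_le_of_le_one_left (norm_nonneg _) hs.2
  · rw [norm_mul, Real.norm_of_nonneg ht.1]
    exact mul_le_of_le_one_left (norm_nonneg _) ht.2

theorem lipschitzWith_diagonalMap_comp {u : ℝ × ℝ → ℝ × ℝ} {K : ℝ≥0} (hu : LipschitzWith K u)
    {s t : ℝ} (hs : s ∈ Icc (0 : ℝ) 1) (ht : t ∈ Icc (0 : ℝ) 1) :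
    LipschitzWith K fun z => diagonalMap s t (u z) := by
  refine LipschitzWith.of_dist_le_mul fun z w => ?_
  rw [dist_eq_norm, ← map_sub]
  refine (norm_diagonalMap_apply_le hs ht _).trans ?_
  rw [← dist_eq_norm]
  exact hu.dist_le_mul z w

theorem smoothFamily_diagonalMap {X : Type*} [TopologicalSpace X] {u : X → ℝ × ℝ → ℝ × ℝ}
    (hu : SmoothFamily u) {s t : ℝ → ℝ} (hs : ContDiff ℝ ∞ s) (ht : ContDiff ℝ ∞ t) :
    SmoothFamily fun x (q : (ℝ × ℝ) × ℝ) => diagonalMap (s q.2) (t q.2) (u x q.1) := by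
  have hu' : SmoothFamily fun x (q : (ℝ × ℝ) × ℝ) => u x q.1 :=
    hu.comp (SmoothFamily.const contDiff_fst)
  exact ((SmoothFamily.const (hs.comp contDiff_snd)).smul
    (hu'.clm_apply (ContinuousLinearMap.fst ℝ ℝ ℝ))).prodMk
    ((SmoothFamily.const (ht.comp contDiff_snd)).smul
      (hu'.clm_apply (ContinuousLinearMap.snd ℝ ℝ ℝ)))

/-- With `d` the lower right entry of `L`, both sides equal `1 + (1 - s) d`: the left one is affine
in `s`, with value `1 + d` at `s = 0` and `1` at `s = 1`. This is why the interpolation below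
preserves area. -/
theorem det_id_add_diagonalMap_eq {L : ℝ × ℝ →L[ℝ] ℝ × ℝ}
    (hL : (ContinuousLinearMap.id ℝ (ℝ × ℝ) + L).det = 1) (s : ℝ) :
    (ContinuousLinearMap.id ℝ (ℝ × ℝ) + (diagonalMap s 1).comp L).det =
      (ContinuousLinearMap.id ℝ (ℝ × ℝ) + (diagonalMap 0 (1 - s)).comp L).det := by
  rw [det_prod_eq] at hL ⊢
  rw [det_prod_eq]
  simp at hL ⊢
  linear_combination s * hL

theorem hasFDerivAt_id_add_diagonalMap {u : ℝ × ℝ → ℝ × ℝ} {z : ℝ × ℝ}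
    (hu : DifferentiableAt ℝ u z) (s t : ℝ) :
    HasFDerivAt (fun z => z + diagonalMap s t (u z))
      (ContinuousLinearMap.id ℝ (ℝ × ℝ) + (diagonalMap s t).comp (fderiv ℝ u z)) z :=
  (hasFDerivAt_id z).add ((diagonalMap s t).hasFDerivAt.comp z hu.hasFDerivAt)

/-- A smooth family of area-preserving perturbations `z ↦ z + u z` of the identity is deformed to
the identity through area-preserving diffeomorphisms. -/
theorem exists_areaPreserving_deformation {X : Type*} [TopologicalSpace X]
    {u : X → ℝ × ℝ → ℝ × ℝ} (hu : SmoothFamily u) (hlip : ∀ x, LipschitzWith (1 / 2) (u x))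
    (hper : ∀ x z, ∀ c ∈ deckLattice, u x (c + z) = u x z)
    (hdet : ∀ x z, (ContinuousLinearMap.id ℝ (ℝ × ℝ) + fderiv ℝ (u x) z).det = 1) :
    ∃ P Q : X → (ℝ × ℝ) × ℝ → ℝ × ℝ, SmoothFamily P ∧ SmoothFamily Q ∧
      (∀ x z s, P x (Q x (z, s), s) = z) ∧ (∀ x z s, Q x (P x (z, s), s) = z) ∧
      (∀ x z s, ∀ c ∈ deckLattice, P x (c + z, s) = c + P x (z, s)) ∧
      (∀ x z s, (fderiv ℝ (fun z => P x (z, s)) z).det = 1) ∧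
      (∀ x z, P x (z, 0) = z) ∧ ∀ x z, P x (z, 1) = z + u x z := by
  -- The cutoff takes values in `[0, 1]` for all real `s`, so the contraction bounds, and with them
  -- the deformation, extend smoothly past the endpoints of the time interval.
  let θ : ℝ → ℝ := Real.smoothTransition
  have hθ : ContDiff ℝ ∞ θ := Real.smoothTransition.contDiff
  have hθ1 : ContDiff ℝ ∞ fun s => 1 - θ s := contDiff_const.sub hθ
  have hmem (s) : θ s ∈ Icc (0 : ℝ) 1 :=
    ⟨Real.smoothTransition.nonneg s, Real.smoothTransition.le_one s⟩
  have hmem1 (s) : 1 - θ s ∈ Icc (0 : ℝ) 1 :=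
    ⟨by linarith [(hmem s).2], by linarith [(hmem s).1]⟩
  have hAf : SmoothFamily fun x (q : (ℝ × ℝ) × ℝ) => diagonalMap 0 (1 - θ q.2) (u x q.1) :=
    smoothFamily_diagonalMap (s := fun _ => 0) hu contDiff_const hθ1
  have hBf : SmoothFamily fun x (q : (ℝ × ℝ) × ℝ) => diagonalMap (θ q.2) 1 (u x q.1) :=
    smoothFamily_diagonalMap (t := fun _ => 1) hu hθ contDiff_const
  have hAl (x s) : LipschitzWith (1 / 2) fun z => diagonalMap 0 (1 - θ s) (u x z) :=
    lipschitzWith_diagonalMap_comp (hlip x) ⟨le_rfl, zero_le_one⟩ (hmem1 s)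
  have hBl (x s) : LipschitzWith (1 / 2) fun z => diagonalMap (θ s) 1 (u x z) :=
    lipschitzWith_diagonalMap_comp (hlip x) (hmem s) ⟨zero_le_one, le_rfl⟩
  obtain ⟨ψA, hψA, hA1, hA2⟩ := exists_smoothFamily_inverse hAf hAl
  obtain ⟨ψB, hψB, hB1, hB2⟩ := exists_smoothFamily_inverse hBf hBl
  have hsnd : SmoothFamily fun (_ : X) (q : (ℝ × ℝ) × ℝ) => q.2 := SmoothFamily.const contDiff_snd
  have hA2' (x z s) : ψA x (z + diagonalMap 0 (1 - θ s) (u x z), s) = z := hA2 x z s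
  have hB2' (x z s) : ψB x (z + diagonalMap (θ s) 1 (u x z), s) = z := hB2 x z s
  -- `P = B_s ∘ A_s⁻¹` and `Q = A_s ∘ B_s⁻¹`, where `ψA` and `ψB` are the inverses of `A_s` and
  -- `B_s`.
  let P : X → (ℝ × ℝ) × ℝ → ℝ × ℝ := fun x q =>
    ψA x q + diagonalMap (θ q.2) 1 (u x (ψA x q))
  let Q : X → (ℝ × ℝ) × ℝ → ℝ × ℝ := fun x q =>
    ψB x q + diagonalMap 0 (1 - θ q.2) (u x (ψB x q))
  have hP : SmoothFamily P := hψA.add (hBf.comp (hψA.prodMk hsnd))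
  have hQ : SmoothFamily Q := hψB.add (hAf.comp (hψB.prodMk hsnd))
  refine ⟨P, Q, hP, hQ, ?_, ?_, ?_, ?_, ?_, ?_⟩
  · intro x z s
    change ψA x (ψB x (z, s) + diagonalMap 0 (1 - θ s) (u x (ψB x (z, s))), s) +
      diagonalMap (θ s) 1 (u x (ψA x (ψB x (z, s) + diagonalMap 0 (1 - θ s)
        (u x (ψB x (z, s))), s))) = z
    rw [hA2']
    exact hB1 x z s
  · intro x z s
    change ψB x (ψA x (z, s) + diagonalMap (θ s) 1 (u x (ψA x (z, s))), s) +
      diagonalMap 0 (1 - θ s) (u x (ψB x (ψA x (z, s) + diagonalMap (θ s) 1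
        (u x (ψA x (z, s))), s))) = z
    rw [hB2']
    exact hA1 x z s
  · intro x z s c hc
    have h1 : ψA x (c + z, s) = c + ψA x (z, s) := by
      have h2 := hA2' x (c + ψA x (z, s)) s
      rw [hper x _ c hc, add_assoc] at h2
      rw [← h2]
      congr 3
      exact (hA1 x z s).symm
    change ψA x (c + z, s) + diagonalMap (θ s) 1 (u x (ψA x (c + z, s))) =
      c + (ψA x (z, s) + diagonalMap (θ s) 1 (u x (ψA x (z, s))))
    rw [h1, hper x _ c hc, add_assoc]
  · intro x z s
    set w := ψA x (z, s) with hw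
    have hud : DifferentiableAt ℝ (u x) w := (hu.contDiff x).differentiable (by simp) w
    have hAd := hasFDerivAt_id_add_diagonalMap hud 0 (1 - θ s)
    have hBd := hasFDerivAt_id_add_diagonalMap hud (θ s) 1
    have hs : ContDiff ℝ ∞ fun z => P x (z, s) :=
      (hP.contDiff x).comp (contDiff_id.prodMk contDiff_const)
    have hz : w + diagonalMap 0 (1 - θ s) (u x w) = z := hA1 x z s
    have hPd : HasFDerivAt (fun z => P x (z, s)) (fderiv ℝ (fun z => P x (z, s)) z)
        (w + diagonalMap 0 (1 - θ s) (u x w)) := by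
      rw [hz]
      exact (hs.differentiable (by simp) z).hasFDerivAt
    have hcomp := hPd.comp w hAd
    have e : ((fun z => P x (z, s)) ∘ fun z => z + diagonalMap 0 (1 - θ s) (u x z)) =
        fun z => z + diagonalMap (θ s) 1 (u x z) := by
      funext z
      change ψA x (z + diagonalMap 0 (1 - θ s) (u x z), s) +
        diagonalMap (θ s) 1 (u x (ψA x (z + diagonalMap 0 (1 - θ s) (u x z), s))) = _
      rw [hA2']
    rw [e] at hcomp
    have hd := congrArg ContinuousLinearMap.det (hcomp.unique hBd)
    rw [det_id_add_diagonalMap_eq (hdet x w)] at hd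
    -- The Jacobian of `A_s` cannot vanish, as `A_s` has the differentiable left inverse `ψA`; it
    -- may therefore be cancelled from `det DP · det DA = det DB`.
    have hne : (ContinuousLinearMap.id ℝ (ℝ × ℝ) +
        (diagonalMap 0 (1 - θ s)).comp (fderiv ℝ (u x) w)).det ≠ 0 := by
      have hψd : DifferentiableAt ℝ (fun z => ψA x (z, s)) (w + diagonalMap 0 (1 - θ s) (u x w)) :=
        ((hψA.contDiff x).comp (contDiff_id.prodMk contDiff_const)).differentiable (by simp) _
      have h1 := hψd.hasFDerivAt.comp w hAd
      rw [show ((fun z => ψA x (z, s)) ∘ fun z => z + diagonalMap 0 (1 - θ s) (u x z)) = id from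
        funext fun z => hA2' x z s] at h1
      have h2 := congrArg ContinuousLinearMap.det (h1.unique (hasFDerivAt_id w))
      rw [ContinuousLinearMap.det, ContinuousLinearMap.toLinearMap_comp, LinearMap.det_comp] at h2
      intro h0
      rw [ContinuousLinearMap.det] at h0
      rw [h0, mul_zero] at h2
      simp [ContinuousLinearMap.det] at h2
    rw [ContinuousLinearMap.det, ContinuousLinearMap.toLinearMap_comp, LinearMap.det_comp] at hd
    exact mul_right_cancel₀ hne (hd.trans (one_mul _).symm)
  · intro x z
    have h := hA1 x z 0
    change ψA x (z, 0) + diagonalMap (θ 0) 1 (u x (ψA x (z, 0))) = z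
    simp only [θ, Real.smoothTransition.zero, sub_zero] at h ⊢
    exact h
  · intro x z
    have h := hA1 x z 1
    simp only [θ, Real.smoothTransition.one, sub_self] at h
    have h0 : ψA x (z, 1) = z := by
      have : diagonalMap 0 0 (u x (ψA x (z, 1))) = 0 := by ext <;> simp
      rwa [this, add_zero] at h
    change ψA x (z, 1) + diagonalMap (θ 1) 1 (u x (ψA x (z, 1))) = _
    rw [h0]
    congr 1
    ext <;> simp [θ]

/-! ## Area-preserving diffeomorphisms from lifts -/

namespace AreaDiffeo

theorem torusProj_eq_of_equivariant {g : ℝ × ℝ → ℝ × ℝ}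
    (hper : ∀ z, ∀ c ∈ deckLattice, g (c + z) = c + g z) {z w : ℝ × ℝ}
    (h : torusProj z = torusProj w) : torusProj (g z) = torusProj (g w) := by
  have hc : z - w ∈ deckLattice := by rw [mem_deckLattice_iff, torusProj_sub, h, sub_self]
  have := hper w (z - w) hc
  rw [sub_add_cancel] at this
  rw [this, torusProj_add, mem_deckLattice_iff.1 hc, zero_add]

/-- The map of the torus with a given lift. -/
noncomputable def descend (g : ℝ × ℝ → ℝ × ℝ) (y : Torus) : Torus :=
  torusProj (g (Function.surjInv torusProj_surjective y))

theorem descend_torusProj {g : ℝ × ℝ → ℝ × ℝ}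
    (hper : ∀ z, ∀ c ∈ deckLattice, g (c + z) = c + g z) (z : ℝ × ℝ) :
    descend g (torusProj z) = torusProj (g z) :=
  torusProj_eq_of_equivariant hper (Function.surjInv_eq torusProj_surjective _)

/-- The area-preserving diffeomorphism with a given lift. -/
noncomputable def ofLift (g : (ℝ × ℝ) ≃ₜ (ℝ × ℝ)) (hg : ContDiff ℝ ∞ g)
    (hg' : ContDiff ℝ ∞ g.symm) (hper : ∀ z, ∀ c ∈ deckLattice, g (c + z) = c + g z)
    (hdet : ∀ z, (fderiv ℝ g z).det = 1) : AreaDiffeo :=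
  have hper' : ∀ z, ∀ c ∈ deckLattice, g.symm (c + z) = c + g.symm z := fun z c hc => by
    rw [Homeomorph.symm_apply_eq, hper _ c hc, g.apply_symm_apply]
  have hlift : IsSmoothLift torusProj univ (descend g) g :=
    ⟨hg.contDiffOn, fun z _ => (descend_torusProj hper z).symm⟩
  { toEquiv :=
      { toFun := descend g
        invFun := descend g.symm
        left_inv := fun y => by
          obtain ⟨z, rfl⟩ := torusProj_surjective y
          rw [descend_torusProj hper, descend_torusProj hper', g.symm_apply_apply]
        right_inv := fun y => by
          obtain ⟨z, rfl⟩ := torusProj_surjective y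
          rw [descend_torusProj hper', descend_torusProj hper, g.apply_symm_apply] }
    smooth := ⟨g, hlift⟩
    smooth_symm := ⟨g.symm, hg'.contDiffOn, fun z _ => (descend_torusProj hper' z).symm⟩
    measurePreserving :=
      measurePreserving_of_lift (continuous_of_lift ⟨g, hlift⟩).measurable g
        (measurePreserving_of_abs_det_eq_one g (hg.differentiable (by simp))
          fun z => by rw [hdet, abs_one])
        (fun z => (descend_torusProj hper z).symm) hper }

theorem ofLift_torusProj (g : (ℝ × ℝ) ≃ₜ (ℝ × ℝ)) (hg : ContDiff ℝ ∞ g)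
    (hg' : ContDiff ℝ ∞ g.symm) (hper : ∀ z, ∀ c ∈ deckLattice, g (c + z) = c + g z)
    (hdet : ∀ z, (fderiv ℝ g z).det = 1) (z : ℝ × ℝ) :
    ofLift g hg hg' hper hdet (torusProj z) = torusProj (g z) :=
  descend_torusProj hper z

end AreaDiffeo

/-! ## Isotopies of maps close to a conjugated rotation -/

theorem IsSmoothLift.contDiff {f : Torus → Torus} {g : ℝ × ℝ → ℝ × ℝ}
    (h : IsSmoothLift torusProj univ f g) : ContDiff ℝ ∞ g := contDiffOn_univ.1 h.contDiffOn

theorem IsSmoothLift.differentiable {f : Torus → Torus} {g : ℝ × ℝ → ℝ × ℝ}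
    (h : IsSmoothLift torusProj univ f g) : Differentiable ℝ g := h.contDiff.differentiable (by simp)

theorem IsSmoothLift.torusProj_apply {f : Torus → Torus} {g : ℝ × ℝ → ℝ × ℝ}
    (h : IsSmoothLift torusProj univ f g) (z : ℝ × ℝ) : torusProj (g z) = f (torusProj z) :=
  h.lifts z (mem_univ z)

theorem exists_eq_add_intCast_univ {g g' : ℝ × ℝ → ℝ × ℝ} (hg : Continuous g) (hg' : Continuous g')
    (h : ∀ z, torusProj (g z) = torusProj (g' z)) :
    ∃ m n : ℤ, ∀ z, g z = g' z + ((m : ℝ), (n : ℝ)) := by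
  obtain ⟨m, n, e⟩ := exists_eq_add_intCast_of_torusProj_eq isPreconnected_univ hg.continuousOn
    hg'.continuousOn fun z _ => h z
  exact ⟨m, n, fun z => e z (mem_univ z)⟩

/-- The derivatives of lifts of inverse maps are inverse to each other. -/
theorem fderiv_comp_fderiv_eq_id {f f' : Torus → Torus} {g g' : ℝ × ℝ → ℝ × ℝ}
    (h : IsSmoothLift torusProj univ f g) (h' : IsSmoothLift torusProj univ f' g')
    (hff' : ∀ y, f (f' y) = y) (z : ℝ × ℝ) :
    (fderiv ℝ g (g' z)).comp (fderiv ℝ g' z) = ContinuousLinearMap.id ℝ (ℝ × ℝ) := by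
  obtain ⟨m, n, e⟩ := exists_eq_add_intCast_univ (h.contDiff.continuous.comp h'.contDiff.continuous)
    continuous_id fun z => by
      rw [Function.comp_apply, h.torusProj_apply, h'.torusProj_apply, hff', id]
  rw [← fderiv_comp z (h.differentiable _) (h'.differentiable z), funext e, fderiv_add_const,
    fderiv_id]

/-- First derivatives enter the metric with weight `1/2`, whence the factor `2`; the bound on `r`
keeps them below the truncation at `1`. -/
theorem norm_fderiv_sub_le_of_edist {f f' : SmoothTorusMap} {g g' : ℝ × ℝ → ℝ × ℝ}
    (h : IsSmoothLift torusProj univ f g) (h' : IsSmoothLift torusProj univ f' g') {r : ℝ}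
    (hr : r ≤ 1 / 2) (hd : edist f f' < ENNReal.ofReal r) (z : ℝ × ℝ) :
    ‖fderiv ℝ g z - fderiv ℝ g' z‖ ≤ 2 * r := by
  have h1 : SmoothMap.jetEDist f f' 1 < ENNReal.ofReal (2 * r) := by
    refine SmoothMap.jetEDist_lt ?_ ?_
    · rw [ENNReal.ofReal_le_one]
      linarith
    · rwa [pow_one, ENNReal.ofReal_mul zero_le_two, ENNReal.ofReal_ofNat, ← mul_assoc,
        ENNReal.inv_mul_cancel two_ne_zero ENNReal.ofNat_ne_top, one_mul]
  have h2 := (le_iSup₂ (f := fun z (_ : z ∈ univ) =>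
    edist (iteratedFDerivWithin ℝ (0 + 1) f.lift univ z)
      (iteratedFDerivWithin ℝ (0 + 1) f'.lift univ z)) z (mem_univ z)).trans_lt h1
  rw [f.isSmoothLift_lift.iteratedFDerivWithin_eq h isPreconnected_univ uniqueDiffOn_univ
      0 (mem_univ z), f'.isSmoothLift_lift.iteratedFDerivWithin_eq h' isPreconnected_univ
      uniqueDiffOn_univ 0 (mem_univ z), iteratedFDerivWithin_univ, iteratedFDerivWithin_univ,
    edist_lt_ofReal, dist_eq_norm, zero_add, ← iteratedFDeriv_sub_apply,
    norm_iteratedFDeriv_one, fderiv_sub (h.differentiable z) (h'.differentiable z)] at h2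
  · exact h2.le
  · exact (h.contDiff.of_le (by exact_mod_cast le_top)).contDiffAt
  · exact (h'.contDiff.of_le (by exact_mod_cast le_top)).contDiffAt

theorem dist_lt_of_edist {f f' : SmoothTorusMap} {r : ℝ} (hr : r ≤ 1)
    (hd : edist f f' < ENNReal.ofReal r) (y : Torus) : dist (f y) (f' y) < r := by
  have h1 : SmoothMap.jetEDist f f' 0 < ENNReal.ofReal r :=
    SmoothMap.jetEDist_lt (by rwa [ENNReal.ofReal_le_one]) (by rwa [pow_zero, one_mul])
  exact edist_lt_ofReal.1 ((le_iSup (fun y => edist (f y) (f' y)) y).trans_lt h1)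

theorem continuous_eval (y : Torus) : Continuous fun f : SmoothTorusMap => f y := by
  refine continuous_iff_continuousAt.2 fun f => EMetric.tendsto_nhds.2 fun c hc => ?_
  filter_upwards [f.eventually_jetEDist_lt 0 hc] with g hg
  exact (le_iSup (fun y => edist (g y) (f y)) y).trans_lt hg

/-- The lift of `f` whose value at `w` is as close to `0` as possible. -/
noncomputable def normalizedLift (f : SmoothTorusMap) (w z : ℝ × ℝ) : ℝ × ℝ :=
  f.lift z - ((round (f.lift w).1 : ℝ), (round (f.lift w).2 : ℝ))

theorem isSmoothLift_normalizedLift (f : SmoothTorusMap) (w : ℝ × ℝ) :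
    IsSmoothLift torusProj univ f (normalizedLift f w) := by
  have h := f.isSmoothLift_lift
  refine ⟨(h.contDiff.sub contDiff_const).contDiffOn, fun z _ => ?_⟩
  rw [normalizedLift, torusProj_sub, torusProj_intCast, sub_zero, h.torusProj_apply]

theorem norm_normalizedLift_self (f : SmoothTorusMap) (w : ℝ × ℝ) :
    ‖normalizedLift f w w‖ = ‖f (torusProj w)‖ := by
  rw [← f.isSmoothLift_lift.torusProj_apply, Prod.norm_def, Prod.norm_def]
  exact congrArg₂ max (UnitAddCircle.norm_eq (x := (f.lift w).1)).symm
    (UnitAddCircle.norm_eq (x := (f.lift w).2)).symm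

/-- Values of norm at most `1/4` differ by at most `1/2`, where the covering preserves norms.
Rounding therefore causes no jump. -/
theorem continuous_normalizedLift_self {X : Type*} [TopologicalSpace X] {f : X → SmoothTorusMap}
    (hf : Continuous f) {w : ℝ × ℝ} (hw : ∀ x, ‖f x (torusProj w)‖ ≤ 1 / 4) :
    Continuous fun x => normalizedLift (f x) w w := by
  refine continuous_iff_continuousAt.2 fun x₀ => tendsto_iff_norm_sub_tendsto_zero.2 ?_
  have h := tendsto_iff_norm_sub_tendsto_zero.1
    (((continuous_eval (torusProj w)).comp hf).tendsto x₀)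
  refine h.congr fun x => ?_
  rw [Function.comp_apply, Function.comp_apply,
    ← (isSmoothLift_normalizedLift (f x) w).torusProj_apply,
    ← (isSmoothLift_normalizedLift (f x₀) w).torusProj_apply, ← torusProj_sub, norm_torusProj_eq]
  refine (norm_sub_le _ _).trans ?_
  rw [norm_normalizedLift_self, norm_normalizedLift_self]
  linarith [hw x, hw x₀]

/-- A contraction that is periodic up to integer vectors is periodic. -/
theorem periodic_of_lipschitz {u : ℝ × ℝ → ℝ × ℝ} (hu : LipschitzWith (1 / 2) u)
    (h : ∀ c ∈ deckLattice, ∃ d ∈ deckLattice, ∀ z, u (z + c) = u z + d) {c : ℝ × ℝ}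
    (hc : c ∈ deckLattice) : Function.Periodic u c := by
  -- A translation of length at most `1` changes `u` by an integer vector of norm at most `1/2`,
  -- which must be `0`.
  have key (e : ℝ × ℝ) (he : e ∈ deckLattice) (hn : ‖e‖ ≤ 1) : Function.Periodic u e := by
    obtain ⟨d, hd, h1⟩ := h e he
    have h2 := hu.norm_sub_le (0 + e) 0
    rw [h1, add_sub_cancel_left, zero_add, sub_zero] at h2
    have h3 : ‖d‖ ≤ 1 / 2 := by
      norm_num at h2
      linarith
    have h4 := norm_torusProj_eq h3
    rw [mem_deckLattice_iff.1 hd, norm_zero] at h4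
    intro z
    rw [h1, norm_eq_zero.1 h4.symm, add_zero]
  have h1 : Function.Periodic u (1, 0) :=
    key _ ⟨⟨1, by simp⟩, ⟨0, by simp⟩⟩ (by simp [Prod.norm_def])
  have h2 : Function.Periodic u (0, 1) :=
    key _ ⟨⟨0, by simp⟩, ⟨1, by simp⟩⟩ (by simp [Prod.norm_def])
  obtain ⟨⟨i, hi⟩, ⟨j, hj⟩⟩ := hc
  have e : c = i • (1, 0) + j • (0, 1) := by
    refine Prod.ext ?_ ?_
    · rw [← hi]; simp
    · rw [← hj]; simp
  rw [e]
  exact (h1.zsmul i).add_period (h2.zsmul j)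

/-- The displacement of the lift of `f ∘ T⁻¹` that is close to the identity, for a map `f` that is
close to `T`, where `σ` is a lift of `T⁻¹`. -/
noncomputable def displacement (σ : ℝ × ℝ → ℝ × ℝ) (f : SmoothTorusMap) (z : ℝ × ℝ) : ℝ × ℝ :=
  normalizedLift f (σ 0) (σ z) - z

section Displacement

variable {T : AreaDiffeo} {σ : ℝ × ℝ → ℝ × ℝ} {r : ℝ}

theorem torusProj_add_displacement (hσ : IsSmoothLift torusProj univ T.symm σ) (f : SmoothTorusMap)
    (z : ℝ × ℝ) : torusProj (z + displacement σ f z) = f (T.symm (torusProj z)) := by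
  rw [displacement, add_sub_cancel, (isSmoothLift_normalizedLift f _).torusProj_apply,
    hσ.torusProj_apply]

theorem contDiff_displacement (hσ : IsSmoothLift torusProj univ T.symm σ) (f : SmoothTorusMap) :
    ContDiff ℝ ∞ (displacement σ f) :=
  ((isSmoothLift_normalizedLift f _).contDiff.comp hσ.contDiff).sub contDiff_id

theorem smoothFamily_displacement {X : Type*} [TopologicalSpace X] {f : X → SmoothTorusMap}
    (hf : Continuous f) (hσ : IsSmoothLift torusProj univ T.symm σ) (hr : r ≤ 1 / 8)
    (hclose : ∀ x, edist (f x) T.toSmooth < ENNReal.ofReal r) :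
    SmoothFamily fun x => displacement σ (f x) := by
  have h0 (x : X) : ‖f x (torusProj (σ 0))‖ ≤ 1 / 4 := by
    have h1 := dist_lt_of_edist (by linarith) (hclose x) (torusProj (σ 0))
    -- The lifts are normalized at `σ 0` because `T` sends that point to `0`, so nearby maps have
    -- small values there.
    have h2 : T.toSmooth (torusProj (σ 0)) = 0 := by
      rw [hσ.torusProj_apply]
      exact T.toEquiv.apply_symm_apply 0
    rw [h2, dist_zero_right] at h1
    linarith
  have hL : SmoothFamily fun x => normalizedLift (f x) (σ 0) :=
    smoothFamily_lift hf (fun x => isSmoothLift_normalizedLift (f x) _)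
      (continuous_normalizedLift_self hf h0)
  have := (hL.comp (SmoothFamily.const hσ.contDiff)).add
    (SmoothFamily.const (X := X) (contDiff_neg (𝕜 := ℝ) (F := ℝ × ℝ)))
  simp only [← sub_eq_add_neg] at this
  exact this

/-- The derivative of `f T⁻¹ - id` factors as `(Df - DT) ∘ DT⁻¹`, and the factors are bounded by `2
r` and `‖Dσ‖`. -/
theorem norm_fderiv_displacement_le (hσ : IsSmoothLift torusProj univ T.symm σ) (hr : r ≤ 1 / 8)
    (hbound : ∀ z, ‖fderiv ℝ σ z‖ * r ≤ 1 / 8) {f : SmoothTorusMap}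
    (hclose : edist f T.toSmooth < ENNReal.ofReal r) (z : ℝ × ℝ) :
    ‖fderiv ℝ (displacement σ f) z‖ ≤ 1 / 4 := by
  obtain ⟨τ, hτ⟩ := T.smooth
  have hL := isSmoothLift_normalizedLift f (σ 0)
  have h1 : fderiv ℝ (displacement σ f) z =
      (fderiv ℝ (normalizedLift f (σ 0)) (σ z) - fderiv ℝ τ (σ z)).comp (fderiv ℝ σ z) := by
    rw [ContinuousLinearMap.sub_comp, fderiv_comp_fderiv_eq_id hτ hσ T.toEquiv.apply_symm_apply,
      ← fderiv_comp z (hL.differentiable _) (hσ.differentiable z)]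
    exact ((((hL.differentiable _).comp z (hσ.differentiable z)).hasFDerivAt).sub
      (hasFDerivAt_id z)).fderiv
  rw [h1]
  have h2 := norm_fderiv_sub_le_of_edist hL (f' := T.toSmooth) hτ (by linarith) hclose (σ z)
  calc _ ≤ _ := ContinuousLinearMap.opNorm_comp_le _ _
    _ ≤ 2 * r * ‖fderiv ℝ σ z‖ := by gcongr
    _ ≤ 1 / 4 := by linarith [hbound z]

theorem lipschitzWith_displacement (hσ : IsSmoothLift torusProj univ T.symm σ) (hr : r ≤ 1 / 8)
    (hbound : ∀ z, ‖fderiv ℝ σ z‖ * r ≤ 1 / 8) {f : SmoothTorusMap}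
    (hclose : edist f T.toSmooth < ENNReal.ofReal r) :
    LipschitzWith (1 / 2) (displacement σ f) := by
  refine lipschitzWith_of_nnnorm_fderiv_le (𝕜 := ℝ)
    ((contDiff_displacement hσ f).differentiable (by simp)) fun z => ?_
  rw [← NNReal.coe_le_coe, coe_nnnorm]
  refine (norm_fderiv_displacement_le hσ hr hbound hclose z).trans ?_
  norm_num

theorem displacement_add (hσ : IsSmoothLift torusProj univ T.symm σ) (hr : r ≤ 1 / 8)
    (hbound : ∀ z, ‖fderiv ℝ σ z‖ * r ≤ 1 / 8) {f : SmoothTorusMap}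
    (hclose : edist f T.toSmooth < ENNReal.ofReal r) (z : ℝ × ℝ) {c : ℝ × ℝ}
    (hc : c ∈ deckLattice) : displacement σ f (c + z) = displacement σ f z := by
  rw [add_comm c z]
  have hcont := (contDiff_displacement hσ f).continuous
  refine periodic_of_lipschitz (lipschitzWith_displacement hσ hr hbound hclose)
    (fun c hc => ?_) hc z
  obtain ⟨m, n, h⟩ := exists_eq_add_intCast_univ
    (g := fun z => (z + c) + displacement σ f (z + c)) (g' := fun z => z + displacement σ f z)
    (by fun_prop) (by fun_prop) fun z => by
      rw [torusProj_add_displacement hσ, torusProj_add_displacement hσ, torusProj_add,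
        mem_deckLattice_iff.1 hc, add_zero]
  refine ⟨((m : ℝ), (n : ℝ)) - c, ?_, fun z => ?_⟩
  · rw [mem_deckLattice_iff, torusProj_sub, torusProj_intCast, mem_deckLattice_iff.1 hc, sub_zero]
  · have : z + c + displacement σ f (z + c) = z + displacement σ f z + ((m : ℝ), (n : ℝ)) := h z
    rw [← add_right_inj (z + c), this]
    abel

/-- Preservation of area gives only `±1`. The entries of the derivative of the displacement are at
most `1/4`, so the determinant is at least `9/16 - 1/16 > 0`. -/
theorem det_id_add_fderiv_displacement (hσ : IsSmoothLift torusProj univ T.symm σ) (hr : r ≤ 1 / 8)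
    (hbound : ∀ z, ‖fderiv ℝ σ z‖ * r ≤ 1 / 8) {F : AreaDiffeo}
    (hclose : edist F.toSmooth T.toSmooth < ENNReal.ofReal r) (z : ℝ × ℝ) :
    (ContinuousLinearMap.id ℝ (ℝ × ℝ) + fderiv ℝ (displacement σ F.toSmooth) z).det = 1 := by
  have hu := contDiff_displacement hσ F.toSmooth
  have h1 := (F.comp T.symm).abs_det_fderiv_eq_one
    (idAddHomeomorph _ (lipschitzWith_displacement hσ hr hbound hclose)) (contDiff_id.add hu)
    (torusProj_add_displacement hσ F.toSmooth) z
  have h2 : HasFDerivAt (idAddHomeomorph _ (lipschitzWith_displacement hσ hr hbound hclose))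
      (ContinuousLinearMap.id ℝ (ℝ × ℝ) + fderiv ℝ (displacement σ F.toSmooth) z) z :=
    (hasFDerivAt_id z).add (hu.differentiable (by simp) z).hasFDerivAt
  rw [h2.fderiv] at h1
  have h3 := norm_fderiv_displacement_le hσ hr hbound hclose z
  set L := fderiv ℝ (displacement σ F.toSmooth) z
  have hb (v : ℝ × ℝ) (hv : ‖v‖ ≤ 1) : |(L v).1| ≤ 1 / 4 ∧ |(L v).2| ≤ 1 / 4 := by
    have h4 : ‖L v‖ ≤ 1 / 4 := (L.le_of_opNorm_le h3 v).trans (by linarith)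
    exact ⟨(norm_fst_le _).trans h4, (norm_snd_le _).trans h4⟩
  obtain ⟨ha, hc⟩ := hb (1, 0) (by simp [Prod.norm_def])
  obtain ⟨hb, hd⟩ := hb (0, 1) (by simp [Prod.norm_def])
  refine (abs_eq zero_le_one).1 h1 |>.resolve_right fun h5 => ?_
  rw [det_prod_eq] at h5
  simp only [add_apply, ContinuousLinearMap.id_apply, Prod.fst_add,
    Prod.snd_add, zero_add] at h5
  rw [abs_le] at ha hb hc hd
  have h6 : |(L (0, 1)).1 * (L (1, 0)).2| ≤ 1 / 4 * (1 / 4) := by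
    rw [abs_mul]
    exact mul_le_mul (abs_le.2 hb) (abs_le.2 hc) (abs_nonneg _) (by norm_num)
  have h7 : 3 / 4 * (3 / 4) ≤ (1 + (L (1, 0)).1) * (1 + (L (0, 1)).2) :=
    mul_le_mul (by linarith [ha.1]) (by linarith [hd.1]) (by norm_num) (by linarith [ha.1])
  linarith [(abs_le.1 h6).2]

end Displacement

/-- The conjugated rotation `H R_a H⁻¹`. -/
noncomputable def conjRotation (H : AreaDiffeo) (a : ℝ) : AreaDiffeo :=
  (H.comp (AreaDiffeo.rotation a)).comp H.symm

theorem conjRotation_zero (H : AreaDiffeo) (y : Torus) : conjRotation H 0 y = y := by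
  change H.toEquiv (H.toEquiv.symm y + (((0 : ℝ) : UnitAddCircle), (0 : UnitAddCircle))) = y
  have : (((0 : ℝ) : UnitAddCircle), (0 : UnitAddCircle)) = 0 := rfl
  rw [this, add_zero, Equiv.apply_symm_apply]

/-- Area-preserving diffeomorphisms close to `H R_a H⁻¹` are isotopic to the identity, and the
isotopies can be chosen continuously. -/
theorem exists_continuous_isotopy {X : Type*} [TopologicalSpace X] {F : X → AreaDiffeo}
    (hF : Continuous fun x => (F x).toSmooth) (H : AreaDiffeo) (a : ℝ) {σ : ℝ × ℝ → ℝ × ℝ} {r : ℝ}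
    (hσ : IsSmoothLift torusProj univ (conjRotation H a).symm σ) (hr : r ≤ 1 / 8)
    (hbound : ∀ z, ‖fderiv ℝ σ z‖ * r ≤ 1 / 8)
    (hclose : ∀ x, edist (F x).toSmooth (conjRotation H a).toSmooth < ENNReal.ofReal r) :
    ∃ Φ : X → SmoothCylinderMap, Continuous Φ ∧ ∀ x, AreaDiffeo.IsIsotopy (Φ x) (F x) := by
  obtain ⟨P, Q, hP, hQ, hPQ, hQP, hper, hdet, hP0, hP1⟩ := exists_areaPreserving_deformation
    (smoothFamily_displacement hF hσ hr hclose)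
    (fun x => lipschitzWith_displacement hσ hr hbound (hclose x))
    (fun x z c hc => displacement_add hσ hr hbound (hclose x) z hc)
    (fun x z => det_id_add_fderiv_displacement hσ hr hbound (hclose x) z)
  have hPs (x s) : ContDiff ℝ ∞ fun z => P x (z, s) :=
    (hP.contDiff x).comp (contDiff_id.prodMk contDiff_const)
  have hQs (x s) : ContDiff ℝ ∞ fun z => Q x (z, s) :=
    (hQ.contDiff x).comp (contDiff_id.prodMk contDiff_const)
  let g (x : X) (s : ℝ) : (ℝ × ℝ) ≃ₜ (ℝ × ℝ) :=
    { toFun := fun z => P x (z, s)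
      invFun := fun z => Q x (z, s)
      left_inv := fun z => hQP x z s
      right_inv := fun z => hPQ x z s
      continuous_toFun := (hPs x s).continuous
      continuous_invFun := (hQs x s).continuous }
  let D (x : X) (s : ℝ) : AreaDiffeo := AreaDiffeo.ofLift (g x s) (hPs x s) (hQs x s)
    (fun z c hc => hper x z s c hc) (fun z => hdet x z s)
  have hD (x s z) : D x s (torusProj z) = torusProj (P x (z, s)) :=
    AreaDiffeo.ofLift_torusProj (g x s) (hPs x s) (hQs x s)
      (fun z c hc => hper x z s c hc) (fun z => hdet x z s) z
  obtain ⟨η, hη⟩ := H.smooth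
  obtain ⟨η', hη'⟩ := H.smooth_symm
  let κ : (ℝ × ℝ) × ℝ → ℝ × ℝ := fun q => η (η' q.1 + (q.2 * a, 0))
  have hκ : ContDiff ℝ ∞ κ := hη.contDiff.comp ((hη'.contDiff.comp contDiff_fst).add
    ((contDiff_snd.mul contDiff_const).prodMk contDiff_const))
  have hκl (z s) : torusProj (κ (z, s)) = conjRotation H (s * a) (torusProj z) := by
    rw [hη.torusProj_apply, torusProj_add, hη'.torusProj_apply]
    rfl
  -- At time `s`, the rotation path `H R_{sa} H⁻¹` is followed by the deformation from the identity
  -- to `F T⁻¹`, where `T = H R_a H⁻¹`; at time `1` this gives `F T⁻¹ T = F`.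
  let L : X → (ℝ × ℝ) × ℝ → ℝ × ℝ := fun x q => P x (κ q, q.2)
  have hL : SmoothFamily L :=
    hP.comp ((SmoothFamily.const hκ).prodMk (SmoothFamily.const contDiff_snd))
  have hlift (x) : IsSmoothLift cylinderProj (univ ×ˢ Icc (0 : ℝ) 1)
      (fun q : Torus × Icc (0 : ℝ) 1 => D x q.2 (conjRotation H (q.2 * a) q.1)) (L x) := by
    refine ⟨(hL.contDiff x).contDiffOn, fun ⟨z, s⟩ hz => ?_⟩
    have hs : ((projIcc 0 1 zero_le_one s : Icc (0 : ℝ) 1) : ℝ) = s :=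
      congrArg Subtype.val (projIcc_of_mem zero_le_one hz.2)
    simp only [cylinderProj, hs]
    rw [← hκl, hD]
  refine ⟨fun x => ⟨_, L x, hlift x⟩, continuous_of_smoothFamily hL hlift, fun x => ⟨?_, ?_, ?_⟩⟩
  · intro y
    change D x 0 (conjRotation H (0 * a) y) = y
    rw [zero_mul, conjRotation_zero]
    obtain ⟨z, rfl⟩ := torusProj_surjective y
    rw [hD, hP0]
  · intro y
    change D x 1 (conjRotation H (1 * a) y) = F x y
    rw [one_mul]
    obtain ⟨z, hz⟩ := torusProj_surjective (conjRotation H a y)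
    rw [← hz, hD, hP1, torusProj_add_displacement hσ, hz]
    exact congrArg (F x) ((conjRotation H a).toEquiv.symm_apply_apply y)
  · exact fun t => ⟨(D x t).comp (conjRotation H (t * a)), fun _ => rfl⟩

/-! ## Stages of convergent constructions -/

theorem IsSmoothLift.exists_norm_fderiv_le {f : Torus → Torus} {g : ℝ × ℝ → ℝ × ℝ}
    (h : IsSmoothLift torusProj univ f g) : ∃ M, ∀ z, ‖fderiv ℝ g z‖ ≤ M := by
  obtain ⟨M, hM⟩ := ((isCompact_Icc (a := (0 : ℝ)) (b := 1)).prod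
    (isCompact_Icc (a := (0 : ℝ)) (b := 1))).exists_bound_of_continuousOn
    (h.contDiff.continuous_fderiv (by simp)).continuousOn
  refine ⟨M, fun z => ?_⟩
  obtain ⟨m, n, hz⟩ := exists_add_intCast_mem_Icc z
  obtain ⟨i, j, e⟩ := exists_eq_add_intCast_univ
    (g := fun z => g (z + ((m : ℝ), (n : ℝ)))) (g' := g)
    (h.contDiff.continuous.comp (continuous_id.add continuous_const)) h.contDiff.continuous
    fun z => by rw [h.torusProj_apply, h.torusProj_apply, torusProj_add_intCast]
  have h1 : fderiv ℝ g (z + ((m : ℝ), (n : ℝ))) = fderiv ℝ g z := by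
    rw [← fderiv_comp_add_right, funext e, fderiv_add_const]
  rw [← h1]
  exact hM _ hz

/-- The inverse of `T` has derivatives bounded by `1 / (8 r)`. -/
def HasTameInverse (T : AreaDiffeo) (r : ℝ) : Prop :=
  r ≤ 1 / 8 ∧ ∃ σ, IsSmoothLift torusProj univ T.symm σ ∧ ∀ z, ‖fderiv ℝ σ z‖ * r ≤ 1 / 8

/-- `C¹` convergence to a diffeomorphism bounds the derivatives of the inverses uniformly for large
`n`, and a bounded quantity times `r n` tends to `0`. -/
theorem eventually_hasTameInverse {T : ℕ → AreaDiffeo} {F : AreaDiffeo}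
    (hT : Tendsto (fun n => (T n).toSmooth) atTop (𝓝 F.toSmooth)) {r : ℕ → ℝ}
    (hr0 : ∀ n, 0 ≤ r n) (hr : Tendsto r atTop (𝓝 0)) :
    ∀ᶠ n in atTop, HasTameInverse (T n) (r n) := by
  obtain ⟨γ, hγ⟩ := F.smooth
  obtain ⟨γ', hγ'⟩ := F.smooth_symm
  obtain ⟨M₀, hM₀⟩ := hγ'.exists_norm_fderiv_le
  set M := max M₀ 1
  have hM1 : 1 ≤ M := le_max_right _ _
  have hM0 : 0 < M := one_pos.trans_le hM1
  have hM (z) : ‖fderiv ℝ γ' z‖ ≤ M := (hM₀ z).trans (le_max_left _ _)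
  have hd : 0 < 1 / (4 * M) := by positivity
  have hd' : 1 / (4 * M) ≤ 1 / 2 := one_div_le_one_div_of_le two_pos (by linarith)
  filter_upwards [EMetric.tendsto_nhds.1 hT _ (ENNReal.ofReal_pos.2 hd),
    hr.eventually_le_const (u := 1 / 8) (by norm_num),
    hr.eventually_le_const (u := 1 / (16 * M)) (by positivity)] with n hn hrn hrn'
  obtain ⟨τ, hτ⟩ := (T n).smooth
  obtain ⟨σ, hσ⟩ := (T n).smooth_symm
  refine ⟨hrn, σ, hσ, fun w => ?_⟩
  -- With `y = Dσ v`, one has `‖y‖ ≤ M ‖Dγ y‖ ≤ M ‖v‖ + ‖y‖ / 2`. The radius `1 / (4 M)` is chosen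
  -- so that the error term is exactly half of `‖y‖`.
  have hnorm : ‖fderiv ℝ σ w‖ ≤ 2 * M := by
    refine ContinuousLinearMap.opNorm_le_bound _ (by positivity) fun v => ?_
    set y := fderiv ℝ σ w v
    have h1 : fderiv ℝ τ (σ w) y = v :=
      congrArg (fun L => L v) (fderiv_comp_fderiv_eq_id hτ hσ (T n).toEquiv.apply_symm_apply w)
    have h2 : fderiv ℝ γ' (γ (σ w)) (fderiv ℝ γ (σ w) y) = y :=
      congrArg (fun L => L y) (fderiv_comp_fderiv_eq_id hγ' hγ F.toEquiv.symm_apply_apply (σ w))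
    have h3 : ‖fderiv ℝ τ (σ w) - fderiv ℝ γ (σ w)‖ ≤ 2 * (1 / (4 * M)) :=
      norm_fderiv_sub_le_of_edist (f := (T n).toSmooth) (f' := F.toSmooth) hτ hγ hd' hn (σ w)
    have h4 : ‖y‖ ≤ M * ‖fderiv ℝ γ (σ w) y‖ := by
      have := ContinuousLinearMap.le_of_opNorm_le _ (hM (γ (σ w))) (fderiv ℝ γ (σ w) y)
      rwa [h2] at this
    have h5 : ‖fderiv ℝ γ (σ w) y‖ ≤ ‖v‖ + 2 * (1 / (4 * M)) * ‖y‖ := by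
      have e : fderiv ℝ γ (σ w) y = v - (fderiv ℝ τ (σ w) - fderiv ℝ γ (σ w)) y := by
        rw [sub_apply, h1, sub_sub_cancel]
      rw [e]
      exact (norm_sub_le _ _).trans (by gcongr; exact ContinuousLinearMap.le_of_opNorm_le _ h3 y)
    have h6 : M * (2 * (1 / (4 * M)) * ‖y‖) = ‖y‖ / 2 := by
      field_simp
      ring
    have h7 : ‖y‖ ≤ M * (‖v‖ + 2 * (1 / (4 * M)) * ‖y‖) := h4.trans (by gcongr)
    rw [mul_add, h6] at h7
    linarith
  calc ‖fderiv ℝ σ w‖ * r n ≤ 2 * M * (1 / (16 * M)) := by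
        gcongr
        exact hr0 n
    _ = 1 / 8 := by
        field_simp
        norm_num

/-! ## Dependence of the stages on the tree -/

theorem TreeSpace.eventually_mem_iff (t : TreeSpace) (τ : List ℕ) :
    ∀ᶠ t' in 𝓝 t, (τ ∈ t.carrier ↔ τ ∈ t'.carrier) := by
  classical
  have h1 : Continuous fun t' : TreeSpace => decide (τ ∈ t'.carrier) :=
    (continuous_apply τ).comp
      (continuous_induced_dom (f := fun (t : TreeSpace) (τ : List ℕ) => decide (τ ∈ t.carrier)))
  filter_upwards [h1.continuousAt.eventually
    ((isOpen_discrete {decide (τ ∈ t.carrier)}).mem_nhds rfl)] with t' ht'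
  exact (decide_eq_decide.1 ht').symm

theorem circ_congr {k l k' l' : ℕ → ℕ} {n : ℕ} (h : ∀ m < n, k m = k' m ∧ l m = l' m) :
    circQ k l n = circQ k' l' n ∧ circP k l n = circP k' l' n := by
  induction n with
  | zero => exact ⟨rfl, rfl⟩
  | succ n ih =>
    obtain ⟨h1, h2⟩ := ih fun m hm => h m (hm.trans n.lt_succ_self)
    obtain ⟨h3, h4⟩ := h n n.lt_succ_self
    simp only [circQ, circP, h1, h2, h3, h4, and_self]

theorem conjugator_congr {h h' : ℕ → AreaDiffeo} {n : ℕ} (hh : ∀ m < n, h m = h' m) :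
    conjugator h n = conjugator h' n := by
  induction n with
  | zero => rfl
  | succ n ih =>
    rw [conjugator, conjugator, ih fun m hm => hh m (hm.trans n.lt_succ_self),
      hh n n.lt_succ_self]

namespace TreeConstruction

variable {σ : ℕ ≃ List ℕ} {ε : ℕ → ℝ} (C : TreeConstruction σ ε)

/-- The conjugating map and the angle of the `n`-th stage. -/
noncomputable def stageData (n : ℕ) (t : TreeSpace) : AreaDiffeo × ℝ :=
  (conjugator (C.run t).h n, circAlpha (C.run t).k (C.run t).l n)

theorem stage_eq_conjRotation (n : ℕ) (t : TreeSpace) :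
    (C.run t).stage n = conjRotation (C.stageData n t).1 (C.stageData n t).2 := rfl

/-- The first `n` stages are determined by finitely many membership conditions on the tree, and each
of these is locally constant. -/
theorem eventually_stageData_eq (n : ℕ) (t : TreeSpace) :
    ∀ᶠ t' in 𝓝 t, ∀ m ≤ n, C.stageData m t' = C.stageData m t := by
  have h : ∀ᶠ t' in 𝓝 t, ∀ m ∈ Iic (t.index σ n), (σ m ∈ t.carrier ↔ σ m ∈ t'.carrier) :=
    (eventually_all_finite (finite_Iic _)).2 fun m _ => t.eventually_mem_iff (σ m)
  filter_upwards [h] with t' ht' m hm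
  have hdep := (C.depends t t' n fun i hi => ht' i hi).2
  have hc := circ_congr (n := m) fun i hi =>
    ⟨(hdep i (hi.trans_le hm)).1, (hdep i (hi.trans_le hm)).2.1⟩
  have hh := conjugator_congr (n := m) fun i hi => (hdep i (hi.trans_le hm)).2.2
  rw [stageData, stageData, circAlpha, circAlpha, hc.1, hc.2, hh]

end TreeConstruction

section Limit

variable {σ : ℕ ≃ List ℕ} {ε : ℕ → ℝ} {C : TreeConstruction σ ε} {F : TreeSpace → AreaDiffeo}

theorem edist_stage_limit_le (hε_pos : ∀ n, 0 < ε n) (hε_sum : Summable ε) (hF : C.IsLimit F)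
    (t : TreeSpace) (n : ℕ) : edist ((C.run t).stage n).toSmooth (F t).toSmooth ≤
      ENNReal.ofReal (∑' m, ε (m + n)) := by
  have h := edist_le_tsum_of_edist_le_of_tendsto (fun n => ENNReal.ofReal (ε n))
    (fun n => ((C.run t).close n).le) (hF t) n
  rw [ENNReal.ofReal_tsum_of_nonneg (fun m => (hε_pos _).le) ((summable_nat_add_iff n).2 hε_sum)]
  simp only [add_comm n] at h
  exact h

/-- The limit is a uniform limit of locally constant maps, because the tail bound is the same for
all trees. -/
theorem continuous_limit (hε_pos : ∀ n, 0 < ε n) (hε_sum : Summable ε) (hF : C.IsLimit F) :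
    Continuous fun t => (F t).toSmooth := by
  refine continuous_iff_continuousAt.2 fun t => EMetric.tendsto_nhds.2 fun c hc => ?_
  have htail : Tendsto (fun n => ENNReal.ofReal (∑' m, ε (m + n)) +
      ENNReal.ofReal (∑' m, ε (m + n))) atTop (𝓝 0) := by
    have h1 := (ENNReal.continuous_ofReal.tendsto 0).comp (tendsto_sum_nat_add ε)
    rw [ENNReal.ofReal_zero] at h1
    simpa using h1.add h1
  obtain ⟨n, hn⟩ := (htail.eventually_lt_const hc).exists
  filter_upwards [C.eventually_stageData_eq n t] with t' ht'
  refine lt_of_le_of_lt ?_ hn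
  have h1 := edist_stage_limit_le hε_pos hε_sum hF t n
  have h2 := edist_stage_limit_le hε_pos hε_sum hF t' n
  rw [C.stage_eq_conjRotation, ht' n le_rfl, ← C.stage_eq_conjRotation, edist_comm] at h2
  exact (edist_triangle _ _ _).trans (add_le_add h2 h1)

theorem exists_continuous_isotopy_limit (hε_pos : ∀ n, 0 < ε n) (hε_sum : Summable ε)
    (hF : C.IsLimit F) : ∃ Φ : TreeSpace → SmoothCylinderMap,
      Continuous Φ ∧ ∀ t : TreeSpace, AreaDiffeo.IsIsotopy (Φ t) (F t) := by
  classical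
  -- The factor `2` makes the distance from the stage to the limit strictly smaller than `r n`.
  let r : ℕ → ℝ := fun n => 2 * ∑' m, ε (m + n)
  have hs (n : ℕ) : Summable fun m => ε (m + n) := (summable_nat_add_iff n).2 hε_sum
  have hpos (n : ℕ) : 0 < ∑' m, ε (m + n) := (hs n).tsum_pos (fun m => (hε_pos _).le) 0 (hε_pos _)
  have hr : Tendsto r atTop (𝓝 0) := by
    simpa using (tendsto_sum_nat_add ε).const_mul 2
  have htame (t : TreeSpace) : ∃ n, HasTameInverse (conjRotation (C.stageData n t).1
      (C.stageData n t).2) (r n) :=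
    (eventually_hasTameInverse (hF t) (fun n => by have := hpos n; positivity) hr).exists
  -- Taking the least tame stage makes the choice locally constant: nearby trees share all stages up
  -- to this one, so they agree on both its tameness and the failure of the earlier ones.
  let N (t : TreeSpace) : ℕ := Nat.find (htame t)
  let d (t : TreeSpace) : ℕ × (AreaDiffeo × ℝ) := (N t, C.stageData (N t) t)
  have hd (t : TreeSpace) : ∀ᶠ t' in 𝓝 t, d t' = d t := by
    filter_upwards [C.eventually_stageData_eq (N t) t] with t' ht'
    have hN : N t' = N t := by
      refine (Nat.find_eq_iff _).2 ⟨?_, fun m hm => ?_⟩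
      · rw [ht' _ le_rfl]
        exact Nat.find_spec (htame t)
      · rw [ht' _ hm.le]
        exact Nat.find_min (htame t) hm
    simp only [d, hN, ht' _ le_rfl]
  have hclose (t : TreeSpace) : edist (F t).toSmooth
      (conjRotation (d t).2.1 (d t).2.2).toSmooth < ENNReal.ofReal (r (d t).1) := by
    rw [edist_comm]
    refine (edist_stage_limit_le hε_pos hε_sum hF t (N t)).trans_lt ?_
    have := hpos (N t)
    exact (ENNReal.ofReal_lt_ofReal_iff (by positivity)).2 (by linarith)
  have hpiece (a : ℕ × (AreaDiffeo × ℝ)) : ∃ Φ : {t // d t = a} → SmoothCylinderMap,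
      Continuous Φ ∧ ∀ t, AreaDiffeo.IsIsotopy (Φ t) (F t) := by
    rcases isEmpty_or_nonempty {t // d t = a} with he | ⟨t, rfl⟩
    · exact ⟨fun t => he.elim t, continuous_of_discreteTopology, fun t => he.elim t⟩
    -- The same stage, radius and lift of the inverse serve for every tree of the piece.
    · obtain ⟨hr8, τ, hτ, hbound⟩ := Nat.find_spec (htame t)
      exact exists_continuous_isotopy
        ((continuous_limit hε_pos hε_sum hF).comp continuous_subtype_val) _ _ hτ hr8 hbound
        fun t' => by
          have h := hclose t'
          rw [t'.2] at h
          exact h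
  choose Ψ hΨc hΨ using hpiece
  refine ⟨fun t => Ψ (d t) ⟨t, rfl⟩, continuous_iff_continuousAt.2 fun t => ?_,
    fun t => hΨ (d t) ⟨t, rfl⟩⟩
  -- The pieces are open, so isotopies chosen independently on them glue to a continuous family.
  have hopen : IsOpen {t' | d t' = d t} := isOpen_iff_mem_nhds.2 fun t' ht' => by
    filter_upwards [hd t'] with t'' h
    exact h.trans ht'
  refine (hopen.isOpenEmbedding_subtypeVal.continuousAt_iff (x := ⟨t, rfl⟩)).1 ?_
  have e : ((fun t => Ψ (d t) ⟨t, rfl⟩) ∘ Subtype.val : {t' // d t' = d t} → _) = Ψ (d t) := by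
    funext ⟨t', ht'⟩
    have key (a : ℕ × (AreaDiffeo × ℝ)) (h : d t' = a) : Ψ (d t') ⟨t', rfl⟩ = Ψ a ⟨t', h⟩ := by
      subst h
      rfl
    exact key _ ht'
  exact e ▸ (hΨc (d t)).continuousAt

end Limit

theorem mainTheorem9 (σ : ℕ ≃ List ℕ)
    (hσ : ∀ (n : ℕ) (τ : List ℕ), τ <+: σ n → ∃ m ≤ n, σ m = τ)
    (ε : ℕ → ℝ) (hε_pos : ∀ n, 0 < ε n) (hε_anti : Antitone ε) (hε_sum : Summable ε)
    (C : TreeConstruction σ ε) (F : TreeSpace → AreaDiffeo) (hF : C.IsLimit F) :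
    (∀ t : TreeSpace, ∃ I : SmoothCylinderMap, AreaDiffeo.IsIsotopy I (F t)) ∧
    ∃ Φ : TreeSpace → SmoothCylinderMap,
      Continuous Φ ∧ ∀ t : TreeSpace, AreaDiffeo.IsIsotopy (Φ t) (F t) := by
  obtain ⟨Φ, hΦ, hI⟩ := exists_continuous_isotopy_limit hε_pos hε_sum hF
  exact ⟨fun t => ⟨Φ t, hI t⟩, Φ, hΦ, hI⟩
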